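/- Let $n,m,q$ be positive integers and $\mathbb T=\mathbb R\cup\{-\infty\}$ with $x\oplus y=\max(x,y)$, $x\otimes y=x+y$. A tropical entire function on $\mathbb R^n$ is a continuous (locally finite) piecewise linear function $g:\mathbb R^n\to\mathbb R$ of the form $g(x)=\max_{i\ge 0}\,(a_i+\langle \mathbf m_i,x\rangle)$ with $a_i\in\mathbb T$, $\mathbf m_i\in\mathbb R^n$. For $u:\mathbb R^n\to\mathbb R$ put $J_u(x;\varphi)=\lim_{h\to0^+}\frac{u(x+h\varphi)-u(x)}{h}+\lim_{h\to0^+}\frac{u(x-h\varphi)-u(x)}{h}$; a root of $u$ is a point $x$ with $J_u(x;\varphi)\ge 0$ for all unit vectors $\varphi$ and $J_u(x;\varphi)>0$ for some $\varphi$. Let $f=[f_0:\dots:f_m]:\mathbb R^n\to\mathbb{TP}^m$ be a tropical holomorphic map with reduced representation $(f_0,\dots,f_m)$, i.e. the $f_i$ are tropical entire functions without a common root. Write $\|f(x)\|=\max_i f_i(x)$ and $$T_f(r)=\frac1{\omega_n}\int_{S^{n-1}(1)}\|f(r\theta)\|\,d\sigma(\theta)-\|f(0)\| ,$$ where $\sigma$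 is the surface measure of the unit sphere and $\omega_n$ its total mass. A homogeneous tropical polynomial of degree $d\ge1$ is $P(x)=\max_{|I|=d}(c_I+i_0x_0+\dots+i_mx_m)$, $I=(i_0,\dots,i_m)\in\mathbb Z_{\ge 0}^{m+1}$, with $c_I\in\mathbb T$ not all $-\infty$; the hypersurface $V_P$ is the set of points where the maximum is attained by at least two monomials, and $\|a\|=\max_I c_I$. Its defect is $$\delta_f(V_P)=\liminf_{r\to\infty}\frac{m_f(r,V_P)}{d\,T_f(r)},\qquad m_f(r,V_P)=\frac1{\omega_n}\int_{S^{n-1}(1)}\bigl(d\|f(r\theta)\|+\|a\|-P(f)(r\theta)\bigr)\,d\sigma(\theta).$$ For $u:\mathbb R^n\to\mathbb R$ let $N(r,u)=\frac12\int_0^r\frac1{\omega_n}\int_{S^{n-1}(1)} n(t,u_\theta)\,d\sigma(\theta)\,dt$, where $u_\theta(s)=u(s\theta)$ and $n(t,u_\theta)=\sum_{|s|<t,\ J_{u_\theta}(s;1)<0}|J_{u_\theta}(s;1)|$. The function $P\circ f$, with $\deg P=d$, is called complete if the least number of finite coefficients $c_I$ in a representation $P\circ f=\max_{|I|=d}(c_I+i_0f_0+\dots+i_mf_m)$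 equals $\binom{m+d}{d}$. Assume that $f$ is tropical algebraically nondegenerate, i.e. for every $d\ge 1$ and every homogeneous tropical polynomial $P$ of degree $d$ one has $f(\mathbb R^n)\not\subset V_P$, and that $\limsup_{r\to\infty}\frac{\log T_f(r)}{r}=0$. Let $P_1,\dots,P_q$ be homogeneous tropical polynomials of degrees $d_1,\dots,d_q\ge1$, let $d=\operatorname{lcm}(d_1,\dots,d_q)$ and $M=\binom{m+d}{d}-1$, and let $\lambda$ be the number of indices $j\in\{M+2,\dots,q\}$ for which $P_j\circ f$ is not complete. Then for every $j=1,\dots,q$ $$\delta_f(V_{P_j})=1-\limsup_{r\to\infty}\frac{N(r,-(P_j\circ f))}{d_j\,T_f(r)},$$ and $$\sum_{j=1}^q\delta_f(V_{P_j})\le M+1+\lambda,\qquad \sum_{j=M+2}^q\delta_f(V_{P_j})\le\lambda .$$ In particular, if $\lambda=0$, then $\delta_f(V_{P_j})=0$ for every $j\in\{M+2,\dots,q\}$. -/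

import Mathlib

open MeasureTheory Filter Topology

noncomputable section

namespace TropicalNevanlinna

/-! ## Directional derivatives, roots and poles -/

/-- The positive directional derivative `lim_{h → 0⁺} (f (x + h φ) - f x) / h`. -/
def dirDeriv {E : Type*} [NormedAddCommGroup E] [NormedSpace ℝ E] (f : E → ℝ) (x φ : E) : ℝ :=
  derivWithin (fun h : ℝ => f (x + h • φ)) (Set.Ici 0) 0

/-- `J_f(x; φ) = ∂⁺_φ f(x) + ∂⁺_{-φ} f(x)`. -/
def jump {E : Type*} [NormedAddCommGroup E] [NormedSpace ℝ E] (f : E → ℝ) (x φ : E) : ℝ :=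
  dirDeriv f x φ + dirDeriv f x (-φ)

/-- `x` is a tropical smooth point of `f`. -/
def IsSmoothPoint {E : Type*} [NormedAddCommGroup E] [NormedSpace ℝ E] (f : E → ℝ) (x : E) :
    Prop :=
  ∀ φ : E, ‖φ‖ = 1 → jump f x φ = 0

/-- `x` is a tropical pole of `f`. -/
def IsPole {E : Type*} [NormedAddCommGroup E] [NormedSpace ℝ E] (f : E → ℝ) (x : E) : Prop :=
  ∃ φ : E, ‖φ‖ = 1 ∧ jump f x φ < 0

/-- `x` is a tropical root of `f`: neither a smooth point nor a pole. -/
def IsRoot {E : Type*} [NormedAddCommGroup E] [NormedSpace ℝ E] (f : E → ℝ) (x : E) : Prop :=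
  ¬ IsSmoothPoint f x ∧ ¬ IsPole f x

/-! ## Spherical means and the counting function -/

/-- `(1 / ω_n) ∫_{S^{n-1}(1)} u dσ`, where `σ` is the surface measure of the unit sphere of `ℝⁿ`
and `ω_n` is its total mass. -/
def sphereMean {n : ℕ} (u : EuclideanSpace ℝ (Fin n) → ℝ) : ℝ :=
  ⨍ θ : Metric.sphere (0 : EuclideanSpace ℝ (Fin n)) 1, u (θ : EuclideanSpace ℝ (Fin n))
    ∂((volume : Measure (EuclideanSpace ℝ (Fin n))).toSphere)

/-- `n(t, g)` for a function `g` of one real variable: the poles of `g` in `(-t, t)`, counted with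
multiplicity. -/
def poleNumber (t : ℝ) (g : ℝ → ℝ) : ℝ :=
  ∑ᶠ x ∈ {x : ℝ | |x| < t ∧ jump g x 1 < 0}, |jump g x 1|

/-- `n(t, f)` on `ℝⁿ`: the mean over all directions `θ` of `n(t, f_θ)`, `f_θ(s) = f(sθ)`. -/
def meanPoleNumber {n : ℕ} (t : ℝ) (f : EuclideanSpace ℝ (Fin n) → ℝ) : ℝ :=
  sphereMean fun θ => poleNumber t fun s : ℝ => f (s • θ)

/-- The counting function `N(r, f) = (1/2) ∫₀^r n(t, f) dt` of the poles of `f`. -/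
def countingFun {n : ℕ} (r : ℝ) (f : EuclideanSpace ℝ (Fin n) → ℝ) : ℝ :=
  (1 / 2) * ∫ t in (0 : ℝ)..r, meanPoleNumber t f

/-! ## Tropical entire functions and holomorphic maps -/

/-- `f` is a (real-valued) tropical entire function on `ℝⁿ`: a continuous piecewise linear function
of the form `max_i (a_i + ⟨m_i, x⟩)` with `a_i ∈ ℝ ∪ {-∞}` and `m_i ∈ ℝⁿ`. The second clause is the
(local finiteness in) piecewise linearity: on every ball finitely many terms realize the maximum. -/
def IsEntire {n : ℕ} (f : EuclideanSpace ℝ (Fin n) → ℝ) : Prop :=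
  ∃ (a : ℕ → WithBot ℝ) (s : ℕ → EuclideanSpace ℝ (Fin n)),
    (∀ x, IsGreatest (Set.range fun i => a i + ((inner ℝ (s i) x : ℝ) : WithBot ℝ))
      ((f x : ℝ) : WithBot ℝ)) ∧
    ∀ R : ℝ, ∃ F : Finset ℕ, ∀ x, ‖x‖ ≤ R →
      ∃ i ∈ F, ((f x : ℝ) : WithBot ℝ) = a i + ((inner ℝ (s i) x : ℝ) : WithBot ℝ)

/-- A tropical holomorphic map `ℝⁿ → 𝕋ℙᵐ`, given by a reduced representation `(f_0, …, f_m)`. -/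
structure HolomorphicMap (n m : ℕ) where
  /-- the components of the reduced representation -/
  comp : Fin (m + 1) → EuclideanSpace ℝ (Fin n) → ℝ
  entire : ∀ i, IsEntire (comp i)
  no_common_root : ¬ ∃ x, ∀ i, IsRoot (comp i) x

/-! ## Homogeneous tropical polynomials and hypersurfaces -/

/-- The multi-indices `(i_0, …, i_m)` of natural numbers with `i_0 + ⋯ + i_m = d`. -/
abbrev MultiIndex (m d : ℕ) : Type :=
  ↥(Finset.piAntidiag (Finset.univ : Finset (Fin (m + 1))) d)

/-- A homogeneous tropical polynomial of degree `d` in `m + 1` variables: coefficients in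
`𝕋 = ℝ ∪ {-∞}`, not all equal to `-∞`. -/
structure HomPoly (m d : ℕ) where
  /-- the coefficients -/
  coeff : MultiIndex m d → WithBot ℝ
  exists_coeff_ne_bot : ∃ I, coeff I ≠ ⊥

namespace HomPoly

variable {m d : ℕ}

/-- The monomials with a finite coefficient. -/
def support (P : HomPoly m d) : Finset (MultiIndex m d) :=
  Finset.univ.filter fun I => P.coeff I ≠ ⊥

theorem support_nonempty (P : HomPoly m d) : P.support.Nonempty := by
  obtain ⟨I, hI⟩ := P.exists_coeff_ne_bot
  exact ⟨I, by simp [support, hI]⟩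

/-- The value `c_I + i_0 x_0 + ⋯ + i_m x_m` of a monomial with finite coefficient. -/
def term (P : HomPoly m d) (I : MultiIndex m d) (x : Fin (m + 1) → ℝ) : ℝ :=
  (P.coeff I).unbotD 0 + ∑ k, ((I : Fin (m + 1) → ℕ) k : ℝ) * x k

/-- `P(x) = max_I (c_I + i_0 x_0 + ⋯ + i_m x_m)`. -/
def eval (P : HomPoly m d) (x : Fin (m + 1) → ℝ) : ℝ :=
  P.support.sup' P.support_nonempty fun I => P.term I x

/-- `‖a‖`, the largest coefficient of `P`. -/
def coeffNorm (P : HomPoly m d) : ℝ :=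
  P.support.sup' P.support_nonempty fun I => (P.coeff I).unbotD 0

/-- The tropical hypersurface `V_P`, in homogeneous coordinates: the points where the maximum
`P(x)` is attained by at least two monomials. -/
def hypersurface (P : HomPoly m d) : Set (Fin (m + 1) → ℝ) :=
  {x | ∃ I ∈ P.support, ∃ J ∈ P.support, I ≠ J ∧ P.term I x = P.eval x ∧ P.term J x = P.eval x}

end HomPoly

namespace HolomorphicMap

variable {n m : ℕ}

/-- The point `(f_0(x), …, f_m(x))`. -/
def point (f : HolomorphicMap n m) (x : EuclideanSpace ℝ (Fin n)) : Fin (m + 1) → ℝ :=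
  fun i => f.comp i x

/-- `‖f(x)‖ = max (f_0(x), …, f_m(x))`. -/
def maxNorm (f : HolomorphicMap n m) (x : EuclideanSpace ℝ (Fin n)) : ℝ :=
  Finset.univ.sup' Finset.univ_nonempty (f.point x)

/-- The tropical Cartan characteristic function `T_f(r)`. -/
def charFun (f : HolomorphicMap n m) (r : ℝ) : ℝ :=
  sphereMean (fun θ => f.maxNorm (r • θ)) - f.maxNorm 0

/-- `f` is tropical algebraically nondegenerate: its image lies in no tropical hypersurface. -/
def AlgNondegenerate (f : HolomorphicMap n m) : Prop :=
  ∀ d : ℕ, 1 ≤ d → ∀ P : HomPoly m d, ¬ Set.range f.point ⊆ P.hypersurface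

/-- `P ∘ f`. -/
def polyComp (f : HolomorphicMap n m) {d : ℕ} (P : HomPoly m d) :
    EuclideanSpace ℝ (Fin n) → ℝ :=
  fun x => P.eval (f.point x)

/-- The shortest length of a representation of `F` as a tropical linear combination (with real
coefficients) of the monomials `f^I` of degree `d`. -/
def shortestLength (f : HolomorphicMap n m) (d : ℕ) (F : EuclideanSpace ℝ (Fin n) → ℝ) : ℕ :=
  sInf {k : ℕ | ∃ Q : HomPoly m d, Q.support.card = k ∧ f.polyComp Q = F}

/-- `P ∘ f` is complete: every representation of it by the monomials `f^I`, `|I| = deg P`, uses all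
`(m + d choose d)` of them. -/
def IsComplete (f : HolomorphicMap n m) {d : ℕ} (P : HomPoly m d) : Prop :=
  f.shortestLength d (f.polyComp P) = (m + d).choose d

/-- The degree of degeneracy of the family `(P_j ∘ f)_{j ∈ S}`: the number of `j ∈ S` for which
`P_j ∘ f` is not complete. -/
def ddg (f : HolomorphicMap n m) {ι : Type*} {deg : ι → ℕ} (P : ∀ j, HomPoly m (deg j))
    (S : Set ι) : ℕ :=
  Set.ncard {j | j ∈ S ∧ ¬ f.IsComplete (P j)}

/-- The Weil function `λ_{V_P}(f(x)) = d ‖f(x)‖ + ‖a‖ - P(f)(x)`. -/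
def weil (f : HolomorphicMap n m) {d : ℕ} (P : HomPoly m d) (x : EuclideanSpace ℝ (Fin n)) : ℝ :=
  d * f.maxNorm x + P.coeffNorm - f.polyComp P x

/-- The proximity function `m_f(r, V_P)`. -/
def proximity (f : HolomorphicMap n m) {d : ℕ} (P : HomPoly m d) (r : ℝ) : ℝ :=
  sphereMean fun θ => f.weil P (r • θ)

/-- The defect `δ_f(V_P) = liminf_{r → ∞} m_f(r, V_P) / (d T_f(r))`. -/
def defect (f : HolomorphicMap n m) {d : ℕ} (P : HomPoly m d) : ℝ :=
  liminf (fun r : ℝ => f.proximity P r / (d * f.charFun r)) atTop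

end HolomorphicMap

end TropicalNevanlinna

end

/-! Everything rests on a Jensen formula. For `u` convex on ℝⁿ and piecewise affine along lines
through the origin, `N(r, -u)` equals the spherical mean of `u` at radius `r` minus `u 0`
(`IsRadiallyPiecewiseAffine.countingFun_neg`). On a line this is a second difference at the origin,
computed from the jumps; Fubini and the antipodal symmetry of the sphere give the general case.
Applied to `P ∘ f`, it yields the first main theorem `m + N = d T + O(1)`
(`proximity_add_countingFun`).

Nondegeneracy forces `T → ∞` (`AlgNondegenerate.tendsto_charFun`). By convexity `T (t r) ≥ t T r`
for `t ≥ 1`, so one positive value suffices. If `T` vanished for all `r > 0`, then `‖f‖` would be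
odd up to a constant, each component would differ from it by a constant, and the image would lie in
a tropical hyperplane.

Dividing the first main theorem by `d T` gives the defect formula, and `N ≥ 0` gives defect at most
1. If `P ∘ f` is complete, `P` contains every pure power `x_k ^ d`; hence `P ∘ f` stays within a
bounded distance of `d ‖f‖`, the proximity function is bounded, and the defect is 0. The two sums
then follow by counting indices. -/

noncomputable section

namespace TropicalNevanlinna

/-! ## Piecewise affine functions of one variable -/

/-- `u` is affine on a right neighbourhood of `0`. -/
def HasAffineGerm (u : ℝ → ℝ) : Prop :=
  ∃ p : ℝ, ∀ᶠ h in 𝓝[≥] (0 : ℝ), u h = u 0 + p * h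

theorem HasAffineGerm.of_eq {u : ℝ → ℝ} (c p : ℝ) (h : ∀ t, u t = c + p * t) :
    HasAffineGerm u :=
  ⟨p, Eventually.of_forall fun t => by rw [h t, h 0]; ring⟩

theorem HasAffineGerm.congr {u v : ℝ → ℝ} (hu : HasAffineGerm u)
    (huv : ∀ᶠ h in 𝓝 (0 : ℝ), v h = u h) : HasAffineGerm v := by
  obtain ⟨p, hp⟩ := hu
  refine ⟨p, ?_⟩
  filter_upwards [hp, nhdsWithin_le_nhds huv] with h h1 h2
  rw [h2, h1, huv.self_of_nhds]

theorem HasAffineGerm.add {u v : ℝ → ℝ} (hu : HasAffineGerm u) (hv : HasAffineGerm v) :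
    HasAffineGerm fun t => u t + v t := by
  obtain ⟨p, hp⟩ := hu
  obtain ⟨q, hq⟩ := hv
  refine ⟨p + q, ?_⟩
  filter_upwards [hp, hq] with h h1 h2
  rw [h1, h2]; ring

theorem HasAffineGerm.const_mul {u : ℝ → ℝ} (c : ℝ) (hu : HasAffineGerm u) :
    HasAffineGerm fun t => c * u t := by
  obtain ⟨p, hp⟩ := hu
  refine ⟨c * p, ?_⟩
  filter_upwards [hp] with h h1
  rw [h1]; ring

/-- If the values at 0 differ, the larger function wins nearby by continuity; if they agree, the
larger slope wins. -/
theorem HasAffineGerm.sup {u v : ℝ → ℝ} (hu : HasAffineGerm u) (hv : HasAffineGerm v) :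
    HasAffineGerm fun t => u t ⊔ v t := by
  wlog huv : v 0 ≤ u 0 generalizing u v
  · simpa only [sup_comm] using this hv hu (le_of_not_ge huv)
  obtain ⟨p, hp⟩ := hu
  obtain ⟨q, hq⟩ := hv
  rcases huv.lt_or_eq with hlt | heq
  · refine ⟨p, ?_⟩
    have h1 : Tendsto (fun h : ℝ => v 0 + q * h) (𝓝[≥] 0) (𝓝 (v 0)) :=
      (Continuous.tendsto' (by fun_prop) 0 _ (by simp)).mono_left nhdsWithin_le_nhds
    have h2 : Tendsto (fun h : ℝ => u 0 + p * h) (𝓝[≥] 0) (𝓝 (u 0)) :=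
      (Continuous.tendsto' (by fun_prop) 0 _ (by simp)).mono_left nhdsWithin_le_nhds
    filter_upwards [hp, hq, h1.eventually_lt h2 hlt] with h h3 h4 h5
    rw [sup_of_le_left huv, h3, h4, sup_of_le_left h5.le]
  · refine ⟨p ⊔ q, ?_⟩
    filter_upwards [hp, hq, self_mem_nhdsWithin] with h h3 h4 h5
    rw [h3, h4, heq, sup_idem, max_mul_of_nonneg _ _ h5, max_add_add_left]

/-- A function of one real variable that is affine on both sides of each point. -/
def IsPiecewiseAffine (φ : ℝ → ℝ) : Prop :=
  ∀ x, HasAffineGerm (fun h => φ (x + h)) ∧ HasAffineGerm (fun h => φ (x - h))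

namespace IsPiecewiseAffine

variable {φ ψ : ℝ → ℝ}

theorem of_eq (c p : ℝ) (h : ∀ t, φ t = c + p * t) : IsPiecewiseAffine φ := fun x =>
  ⟨.of_eq (c + p * x) p fun t => by rw [h]; ring,
    .of_eq (c + p * x) (-p) fun t => by rw [h]; ring⟩

theorem add (hφ : IsPiecewiseAffine φ) (hψ : IsPiecewiseAffine ψ) :
    IsPiecewiseAffine fun t => φ t + ψ t :=
  fun x => ⟨(hφ x).1.add (hψ x).1, (hφ x).2.add (hψ x).2⟩

theorem const_mul (c : ℝ) (hφ : IsPiecewiseAffine φ) : IsPiecewiseAffine fun t => c * φ t :=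
  fun x => ⟨(hφ x).1.const_mul c, (hφ x).2.const_mul c⟩

theorem sup (hφ : IsPiecewiseAffine φ) (hψ : IsPiecewiseAffine ψ) :
    IsPiecewiseAffine fun t => φ t ⊔ ψ t :=
  fun x => ⟨(hφ x).1.sup (hψ x).1, (hφ x).2.sup (hψ x).2⟩

theorem sum {ι : Type*} (s : Finset ι) {φ : ι → ℝ → ℝ}
    (h : ∀ i ∈ s, IsPiecewiseAffine (φ i)) : IsPiecewiseAffine fun t => ∑ i ∈ s, φ i t := by
  classical
  induction s using Finset.induction_on with
  | empty => exact of_eq 0 0 (by simp)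
  | insert a s ha ih =>
    simp only [Finset.sum_insert ha]
    exact (h a (by simp)).add (ih fun i hi => h i (by simp [hi]))

theorem finset_sup' {ι : Type*} (s : Finset ι) (hs : s.Nonempty) {φ : ι → ℝ → ℝ}
    (h : ∀ i ∈ s, IsPiecewiseAffine (φ i)) :
    IsPiecewiseAffine fun t => s.sup' hs fun i => φ i t := by
  classical
  induction hs using Finset.Nonempty.cons_induction with
  | singleton a => simpa using h a (by simp)
  | cons a s ha hs ih =>
    simp only [Finset.sup'_cons hs]
    exact (h a (by simp)).sup (ih fun i hi => h i (by simp [hi]))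

/-- Needed because an entire function is a maximum of finitely many affine functions only on bounded
sets. -/
theorem congr_local (h : ∀ x, ∃ ψ, IsPiecewiseAffine ψ ∧ ∀ᶠ y in 𝓝 x, φ y = ψ y) :
    IsPiecewiseAffine φ := by
  intro x
  obtain ⟨ψ, hψ, he⟩ := h x
  refine ⟨(hψ x).1.congr ?_, (hψ x).2.congr ?_⟩
  · exact (Continuous.tendsto' (f := fun h : ℝ => x + h) (by fun_prop) 0 x (by simp)).eventually he
  · exact (Continuous.tendsto' (f := fun h : ℝ => x - h) (by fun_prop) 0 x (by simp)).eventually he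

theorem abs_sub (a : ℝ) : IsPiecewiseAffine fun t => |t - a| := by
  have h : (fun t : ℝ => |t - a|) = fun t => (t - a) ⊔ (a - t) := by
    funext t; rw [abs, neg_sub]
  rw [h]
  exact (of_eq (-a) 1 fun t => by ring).sup (of_eq a (-1) fun t => by ring)

end IsPiecewiseAffine

/-! ## Jumps of piecewise affine functions -/

theorem dirDeriv_eq_of_eventually {u : ℝ → ℝ} {x φ p : ℝ}
    (h : ∀ᶠ t in 𝓝[≥] (0 : ℝ), u (x + t * φ) = u x + p * t) : dirDeriv u x φ = p := by
  have h1 : HasDerivWithinAt (fun t : ℝ => u x + p * t) p (Set.Ici 0) 0 := by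
    simpa using ((hasDerivAt_id (0 : ℝ)).const_mul p |>.const_add (u x)).hasDerivWithinAt
  have h2 : HasDerivWithinAt (fun t : ℝ => u (x + t • φ)) p (Set.Ici 0) 0 :=
    h1.congr_of_eventuallyEq (by simpa [EventuallyEq] using h) (by simp)
  exact h2.derivWithin (uniqueDiffOn_Ici (0 : ℝ) 0 (by simp))

/-- Both slopes point outward from `x`, so absence of a jump means `q = -p`. -/
theorem IsPiecewiseAffine.exists_jump {φ : ℝ → ℝ} (hφ : IsPiecewiseAffine φ) (x : ℝ) :
    ∃ p q : ℝ, jump φ x 1 = p + q ∧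
      ∀ᶠ h in 𝓝[≥] (0 : ℝ), φ (x + h) = φ x + p * h ∧ φ (x - h) = φ x + q * h := by
  obtain ⟨⟨p, hp⟩, ⟨q, hq⟩⟩ := hφ x
  simp only [add_zero, sub_zero] at hp hq
  refine ⟨p, q, ?_, hp.and hq⟩
  rw [jump, dirDeriv_eq_of_eventually (p := p) (by simpa using hp),
    dirDeriv_eq_of_eventually (p := q) (by simpa [sub_eq_add_neg] using hq)]

theorem jump_eq_of_eventually {φ : ℝ → ℝ} {x p q : ℝ}
    (h : ∀ᶠ h in 𝓝[≥] (0 : ℝ), φ (x + h) = φ x + p * h ∧ φ (x - h) = φ x + q * h) :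
    jump φ x 1 = p + q := by
  rw [jump, dirDeriv_eq_of_eventually (p := p) (by simpa using h.mono fun _ h => h.1),
    dirDeriv_eq_of_eventually (p := q) (by simpa [sub_eq_add_neg] using h.mono fun _ h => h.2)]

theorem IsPiecewiseAffine.jump_add {φ ψ : ℝ → ℝ} (hφ : IsPiecewiseAffine φ)
    (hψ : IsPiecewiseAffine ψ) (x : ℝ) :
    jump (fun t => φ t + ψ t) x 1 = jump φ x 1 + jump ψ x 1 := by
  obtain ⟨p, q, h1, h2⟩ := hφ.exists_jump x
  obtain ⟨p', q', h1', h2'⟩ := hψ.exists_jump x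
  rw [h1, h1', jump_eq_of_eventually (p := p + p') (q := q + q')]
  · ring
  · filter_upwards [h2, h2'] with h a b
    rw [a.1, a.2, b.1, b.2]
    constructor <;> ring

theorem IsPiecewiseAffine.jump_const_mul {φ : ℝ → ℝ} (hφ : IsPiecewiseAffine φ) (c x : ℝ) :
    jump (fun t => c * φ t) x 1 = c * jump φ x 1 := by
  obtain ⟨p, q, h1, h2⟩ := hφ.exists_jump x
  rw [h1, jump_eq_of_eventually (p := c * p) (q := c * q)]
  · ring
  · filter_upwards [h2] with h a
    rw [a.1, a.2]
    constructor <;> ring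

theorem IsPiecewiseAffine.jump_neg {φ : ℝ → ℝ} (hφ : IsPiecewiseAffine φ) (x : ℝ) :
    jump (fun t => -φ t) x 1 = -jump φ x 1 := by
  simpa using hφ.jump_const_mul (-1) x

theorem IsPiecewiseAffine.jump_sum {ι : Type*} (s : Finset ι) {φ : ι → ℝ → ℝ}
    (h : ∀ i ∈ s, IsPiecewiseAffine (φ i)) (x : ℝ) :
    jump (fun t => ∑ i ∈ s, φ i t) x 1 = ∑ i ∈ s, jump (φ i) x 1 := by
  classical
  induction s using Finset.induction_on with
  | empty =>
    simp only [Finset.sum_empty]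
    rw [jump_eq_of_eventually (p := 0) (q := 0)] <;> simp
  | insert a s ha ih =>
    simp only [Finset.sum_insert ha]
    rw [IsPiecewiseAffine.jump_add (h a (by simp)) (.sum s fun i hi => h i (by simp [hi])),
      ih fun i hi => h i (by simp [hi])]

theorem jump_abs_sub (a x : ℝ) : jump (fun t => |t - a|) x 1 = if x = a then 2 else 0 := by
  rcases lt_trichotomy x a with h | h | h
  · rw [if_neg h.ne, jump_eq_of_eventually (p := -1) (q := 1) (x := x)]
    · norm_num
    · filter_upwards [self_mem_nhdsWithin, nhdsWithin_le_nhds (Iio_mem_nhds (sub_pos.2 h))]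
        with t h1 h2
      have h1' : 0 ≤ t := h1
      have h2' : t < a - x := h2
      rw [abs_of_nonpos (by linarith), abs_of_nonpos (by linarith), abs_of_nonpos (by linarith)]
      constructor <;> ring
  · rw [if_pos h, jump_eq_of_eventually (p := 1) (q := 1) (x := x)]
    · norm_num
    · filter_upwards [self_mem_nhdsWithin] with t h1
      have h1' : 0 ≤ t := h1
      subst h
      rw [add_sub_cancel_left, sub_sub_cancel_left, abs_neg, sub_self, abs_zero, abs_of_nonneg h1']
      constructor <;> ring
  · rw [if_neg h.ne', jump_eq_of_eventually (p := 1) (q := -1) (x := x)]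
    · norm_num
    · filter_upwards [self_mem_nhdsWithin, nhdsWithin_le_nhds (Iio_mem_nhds (sub_pos.2 h))]
        with t h1 h2
      have h1' : 0 ≤ t := h1
      have h2' : t < x - a := h2
      rw [abs_of_nonneg (by linarith), abs_of_nonneg (by linarith), abs_of_nonneg (by linarith)]
      constructor <;> ring

/-- Midpoint convexity at `x ± h`, with `h` small enough for both one-sided affine formulas. -/
theorem IsPiecewiseAffine.jump_nonneg {φ : ℝ → ℝ} (hφ : IsPiecewiseAffine φ)
    (hc : ConvexOn ℝ Set.univ φ) (x : ℝ) : 0 ≤ jump φ x 1 := by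
  obtain ⟨p, q, h1, h2⟩ := hφ.exists_jump x
  obtain ⟨h, ⟨ha, hb⟩, hpos⟩ :=
    ((h2.filter_mono (nhdsWithin_mono _ Set.Ioi_subset_Ici_self)).and
      (self_mem_nhdsWithin : Set.Ioi (0 : ℝ) ∈ 𝓝[>] 0)).exists
  have hpos' : 0 < h := hpos
  have := hc.2 (Set.mem_univ (x + h)) (Set.mem_univ (x - h))
    (by norm_num : (0 : ℝ) ≤ 1 / 2) (by norm_num : (0 : ℝ) ≤ 1 / 2) (by norm_num)
  simp only [smul_eq_mul] at this
  rw [show (1 / 2 * (x + h) + 1 / 2 * (x - h) : ℝ) = x by ring, ha, hb] at this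
  rw [h1]
  have : 0 ≤ (p + q) * h := by linarith
  exact nonneg_of_mul_nonneg_left this hpos'

/-- Near each point, a piecewise affine function is affine on either side, with slopes `p`, `-q`. -/
theorem IsPiecewiseAffine.exists_slopes {φ : ℝ → ℝ} (hφ : IsPiecewiseAffine φ) (x : ℝ) :
    ∃ p q : ℝ, jump φ x 1 = p + q ∧ ∃ ε > 0, ∀ h, 0 ≤ h → h < ε →
      φ (x + h) = φ x + p * h ∧ φ (x - h) = φ x + q * h := by
  obtain ⟨p, q, h1, h2⟩ := hφ.exists_jump x
  refine ⟨p, q, h1, ?_⟩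
  obtain ⟨ε, hε, h⟩ := mem_nhdsGE_iff_exists_Ico_subset.1 h2
  exact ⟨ε, hε, fun t h0 ht => h ⟨h0, ht⟩⟩

theorem jump_eq_zero_of_affine {φ : ℝ → ℝ} {y c p : ℝ} (h : ∀ᶠ z in 𝓝 y, φ z = c + p * z) :
    jump φ y 1 = 0 := by
  have e1 := (Continuous.tendsto' (f := fun h : ℝ => y + h) (by fun_prop) 0 y
    (by simp)).eventually h
  have e2 := (Continuous.tendsto' (f := fun h : ℝ => y - h) (by fun_prop) 0 y
    (by simp)).eventually h
  rw [jump_eq_of_eventually (p := p) (q := -p), add_neg_cancel]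
  filter_upwards [nhdsWithin_le_nhds e1, nhdsWithin_le_nhds e2] with t a b
  rw [a, b, h.self_of_nhds]
  constructor <;> ring

/-- One-sided affinity at `x` rules out jumps in a punctured neighbourhood of `x`; compactness of
`[-R, R]` then leaves finitely many candidates. -/
theorem IsPiecewiseAffine.finite_jump {φ : ℝ → ℝ} (hφ : IsPiecewiseAffine φ) (R : ℝ) :
    {x : ℝ | |x| ≤ R ∧ jump φ x 1 ≠ 0}.Finite := by
  have key : ∀ x : ℝ, ∃ ε > 0, ∀ y, |y - x| < ε → jump φ y 1 ≠ 0 → y = x := by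
    intro x
    obtain ⟨p, q, -, ε, hε, h⟩ := hφ.exists_slopes x
    refine ⟨ε, hε, fun y hy hj => ?_⟩
    by_contra hne
    rw [abs_lt] at hy
    rcases lt_or_gt_of_ne hne with hlt | hlt
    · refine hj (jump_eq_zero_of_affine (c := φ x + q * x) (p := -q) ?_)
      filter_upwards [Ioo_mem_nhds (show x - ε < y by linarith) hlt] with z hz
      have := (h (x - z) (by linarith [hz.2]) (by linarith [hz.1])).2
      rw [sub_sub_cancel] at this
      rw [this]; ring
    · refine hj (jump_eq_zero_of_affine (c := φ x - p * x) (p := p) ?_)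
      filter_upwards [Ioo_mem_nhds hlt (show y < x + ε by linarith)] with z hz
      have := (h (z - x) (by linarith [hz.1]) (by linarith [hz.2])).1
      rw [add_sub_cancel] at this
      rw [this]; ring
  choose ε hε hk using key
  obtain ⟨t, -, ht⟩ := (isCompact_Icc (a := -R) (b := R)).elim_nhds_subcover
    (fun x => Metric.ball x (ε x)) fun x _ => Metric.ball_mem_nhds x (hε x)
  refine t.finite_toSet.subset fun y hy => ?_
  obtain ⟨x, hx, hyx⟩ := Set.mem_iUnion₂.1 (ht (abs_le.1 hy.1))
  rw [hk x y (by simpa [Real.dist_eq] using hyx) hy.2]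
  exact hx

/-- Without a jump the two one-sided formulas merge, so the derivative is locally constant, hence
constant on the interval. -/
theorem IsPiecewiseAffine.exists_affine_of_jump_eq_zero {φ : ℝ → ℝ} (hφ : IsPiecewiseAffine φ)
    {R : ℝ} (h0 : ∀ x, |x| < R → jump φ x 1 = 0) :
    ∃ c p : ℝ, ∀ x, |x| < R → φ x = c + p * x := by
  have loc : ∀ x ∈ Set.Ioo (-R) R, ∃ p, ∀ᶠ y in 𝓝 x, φ y = φ x + p * (y - x) := by
    intro x hx
    obtain ⟨p, q, hj, ε, hε, h⟩ := hφ.exists_slopes x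
    have hq : q = -p := by linarith [h0 x (abs_lt.2 hx)]
    refine ⟨p, ?_⟩
    filter_upwards [Ioo_mem_nhds (show x - ε < x by linarith) (show x < x + ε by linarith)]
      with y hy
    rcases le_total x y with hxy | hxy
    · have := (h (y - x) (by linarith) (by linarith [hy.2])).1
      rwa [add_sub_cancel] at this
    · have := (h (x - y) (by linarith) (by linarith [hy.1])).2
      rw [sub_sub_cancel] at this
      rw [this, hq]; ring
  have der : ∀ x p, (∀ᶠ y in 𝓝 x, φ y = φ x + p * (y - x)) → HasDerivAt φ p x := by
    intro x p h
    have h1 : HasDerivAt (fun y : ℝ => φ x + p * (y - x)) p x := by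
      simpa using (((hasDerivAt_id x).sub_const x).const_mul p).const_add (φ x)
    exact h1.congr_of_eventuallyEq h
  have der2 : ∀ x ∈ Set.Ioo (-R) R, HasDerivAt (deriv φ) 0 x := by
    intro x hx
    obtain ⟨p, hp⟩ := loc x hx
    refine (hasDerivAt_const x p).congr_of_eventuallyEq ?_
    filter_upwards [hp.eventually_nhds] with y hy
    refine (der y p ?_).deriv
    filter_upwards [hy] with z hz
    rw [hz, hy.self_of_nhds]; ring
  have hd : ∀ x ∈ Set.Ioo (-R) R, DifferentiableAt ℝ φ x := fun x hx => by
    obtain ⟨p, hp⟩ := loc x hx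
    exact (der x p hp).differentiableAt
  obtain ⟨p, hp⟩ := isOpen_Ioo.exists_is_const_of_deriv_eq_zero (𝕜 := ℝ)
    (isPreconnected_Ioo (a := -R) (b := R)) (f := deriv φ)
    (fun x hx => (der2 x hx).differentiableAt.differentiableWithinAt)
    (fun x hx => (der2 x hx).deriv)
  have hsub : ∀ x ∈ Set.Ioo (-R) R, HasDerivAt (fun x => φ x - p * x) 0 x := by
    intro x hx
    have := ((hd x hx).hasDerivAt).fun_sub ((hasDerivAt_id' x).const_mul p)
    rwa [hp x hx, mul_one, sub_self] at this
  obtain ⟨c, hc⟩ := isOpen_Ioo.exists_is_const_of_deriv_eq_zero (𝕜 := ℝ)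
    (isPreconnected_Ioo (a := -R) (b := R)) (f := fun x => φ x - p * x)
    (fun x hx => (hsub x hx).differentiableAt.differentiableWithinAt)
    (fun x hx => (hsub x hx).deriv)
  exact ⟨c, p, fun x hx => by linarith [hc x (abs_lt.1 hx)]⟩

/-! ### The Jensen formula on a line -/

/-- The second difference at 0 of `t ↦ |t - x|`, whose only jump is 2 at `x`: this is the Jensen
kernel. -/
theorem abs_sub_add_abs_add {r x : ℝ} (hr : 0 ≤ r) :
    |r - x| + |-r - x| - 2 * |0 - x| = 2 * max (r - |x|) 0 := by
  rcases max_cases (r - |x|) 0 with h | h <;> rcases abs_cases x with h1 | h1 <;>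
    rcases abs_cases (r - x) with h2 | h2 <;> rcases abs_cases (-r - x) with h3 | h3 <;>
    rcases abs_cases (0 - x) with h4 | h4 <;> linarith

/-- One-dimensional Jensen formula: the second difference at the origin in terms of the jumps. -/
theorem IsPiecewiseAffine.second_difference {φ : ℝ → ℝ} (hφ : IsPiecewiseAffine φ) {R : ℝ}
    {B : Finset ℝ} (hB : ∀ x, x ∈ B ↔ |x| ≤ R ∧ jump φ x 1 ≠ 0) {r : ℝ} (h0 : 0 ≤ r)
    (hr : r < R) :
    φ r + φ (-r) - 2 * φ 0 = ∑ x ∈ B, jump φ x 1 * max (r - |x|) 0 := by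
  have hpl : ∀ a ∈ B, IsPiecewiseAffine fun t => -(jump φ a 1 / 2) * |t - a| :=
    fun a _ => (IsPiecewiseAffine.abs_sub a).const_mul _
  -- Adding `-(jump / 2) |t - a|` for each `a ∈ B` cancels all jumps in the interval, leaving an
  -- affine function, whose second difference is zero.
  obtain ⟨c, p, hcp⟩ := (hφ.add (.sum B hpl)).exists_affine_of_jump_eq_zero (R := R) (by
    intro x hx
    rw [hφ.jump_add (.sum B hpl), IsPiecewiseAffine.jump_sum B hpl]
    simp only [(IsPiecewiseAffine.abs_sub _).jump_const_mul, jump_abs_sub]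
    by_cases hxB : x ∈ B
    · simp [hxB]
    · have : jump φ x 1 = 0 := by
        by_contra hne
        exact hxB ((hB x).2 ⟨hx.le, hne⟩)
      simp [hxB, this])
  have e1 := hcp r (by rwa [abs_of_nonneg h0])
  have e2 := hcp (-r) (by rwa [abs_neg, abs_of_nonneg h0])
  have e3 := hcp 0 (by simpa using h0.trans_lt hr)
  have e4 : ∑ x ∈ B, jump φ x 1 * max (r - |x|) 0 =
      -((∑ x ∈ B, -(jump φ x 1 / 2) * |r - x|) + (∑ x ∈ B, -(jump φ x 1 / 2) * |-r - x|)
        - 2 * ∑ x ∈ B, -(jump φ x 1 / 2) * |0 - x|) := by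
    rw [Finset.mul_sum, ← Finset.sum_add_distrib, ← Finset.sum_sub_distrib, ←
        Finset.sum_neg_distrib]
    refine Finset.sum_congr rfl fun x _ => ?_
    linear_combination (-(jump φ x 1 / 2)) * abs_sub_add_abs_add (x := x) h0
  rw [e4]
  linear_combination e1 + e2 - 2 * e3

/-- By convexity all jumps of `φ` are nonnegative, so the poles of `-φ` are exactly the nonzero
jumps of `φ`, and the sum runs over a fixed finite set independent of `t`. -/
theorem IsPiecewiseAffine.poleNumber_neg {φ : ℝ → ℝ} (hφ : IsPiecewiseAffine φ)
    (hc : ConvexOn ℝ Set.univ φ) {R : ℝ}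
    {B : Finset ℝ} (hB : ∀ x, x ∈ B ↔ |x| ≤ R ∧ jump φ x 1 ≠ 0) {t : ℝ} (ht : t ≤ R) :
    poleNumber t (fun s => -φ s) = ∑ x ∈ B, if |x| < t then jump φ x 1 else 0 := by
  have hset : {x : ℝ | |x| < t ∧ jump (fun s => -φ s) x 1 < 0} =
      ((B.filter fun x => |x| < t : Finset ℝ) : Set ℝ) := by
    ext x
    simp only [hφ.jump_neg, Set.mem_ofPred_eq, Finset.coe_filter, hB, neg_lt_zero]
    constructor
    · rintro ⟨h1, h2⟩
      exact ⟨⟨h1.le.trans ht, h2.ne'⟩, h1⟩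
    · rintro ⟨⟨-, h1⟩, h2⟩
      exact ⟨h2, (hφ.jump_nonneg hc x).lt_of_ne' h1⟩
  rw [poleNumber, hset, finsum_mem_coe_finset, Finset.sum_filter]
  refine Finset.sum_congr rfl fun x _ => ?_
  rw [hφ.jump_neg, abs_neg, abs_of_nonneg (hφ.jump_nonneg hc x)]

theorem poleNumber_nonneg (t : ℝ) (u : ℝ → ℝ) : 0 ≤ poleNumber t u :=
  finsum_nonneg fun _ => finsum_nonneg fun _ => abs_nonneg _

theorem poleNumber_of_nonpos {t : ℝ} (ht : t ≤ 0) (u : ℝ → ℝ) : poleNumber t u = 0 := by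
  have : {x : ℝ | |x| < t ∧ jump u x 1 < 0} = ∅ := by
    ext x
    simp only [Set.mem_ofPred_eq, Set.mem_empty_iff_false, iff_false, not_and]
    intro h
    linarith [abs_nonneg x]
  rw [poleNumber, this, finsum_mem_empty]

theorem IsPiecewiseAffine.exists_finset_jump {φ : ℝ → ℝ} (hφ : IsPiecewiseAffine φ) (R : ℝ) :
    ∃ B : Finset ℝ, ∀ x, x ∈ B ↔ |x| ≤ R ∧ jump φ x 1 ≠ 0 :=
  ⟨(hφ.finite_jump R).toFinset, fun x => by simp⟩

/-- A jump at distance `a` from 0 is counted once `t > a`; its integral is the same kernel as in the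
second difference. -/
theorem integrableOn_and_integral_step (J a : ℝ) {r : ℝ} (ha : 0 ≤ a) :
    IntegrableOn (fun t => if a < t then J else 0) (Set.Ioc 0 r) ∧
      ∫ t in Set.Ioc 0 r, (if a < t then J else 0) = J * max (r - a) 0 := by
  have he : (fun t : ℝ => if a < t then J else 0) = (Set.Ioi a).indicator fun _ => J := by
    funext t; simp [Set.indicator_apply]
  have hs : Set.Ioc 0 r ∩ Set.Ioi a = Set.Ioc a r := by
    ext t
    simp only [Set.mem_inter_iff, Set.mem_Ioc, Set.mem_Ioi]
    constructor
    · rintro ⟨⟨_, h⟩, h'⟩; exact ⟨h', h⟩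
    · rintro ⟨h', h⟩; exact ⟨⟨by linarith, h⟩, h'⟩
  rw [he]
  refine ⟨(integrable_const J).indicator measurableSet_Ioi, ?_⟩
  rw [setIntegral_indicator measurableSet_Ioi, hs, setIntegral_const, smul_eq_mul, mul_comm,
    Measure.real, Real.volume_Ioc, ENNReal.toReal_ofReal']

/-- One-dimensional Jensen formula. -/
theorem IsPiecewiseAffine.integral_poleNumber_neg {φ : ℝ → ℝ} (hφ : IsPiecewiseAffine φ)
    (hc : ConvexOn ℝ Set.univ φ) {r : ℝ} (hr : 0 ≤ r) :
    IntegrableOn (fun t => poleNumber t fun s => -φ s) (Set.Ioc 0 r) ∧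
      ∫ t in Set.Ioc 0 r, poleNumber t (fun s => -φ s) = φ r + φ (-r) - 2 * φ 0 := by
  -- The margin provides the strict inequality `r < R` that `second_difference` requires.
  obtain ⟨B, hB⟩ := hφ.exists_finset_jump (r + 1)
  have he : Set.EqOn (fun t => ∑ x ∈ B, if |x| < t then jump φ x 1 else 0)
      (fun t => poleNumber t fun s => -φ s) (Set.Ioc 0 r) := fun t ht =>
    (hφ.poleNumber_neg hc hB (by linarith [ht.2])).symm
  have hint := fun x => integrableOn_and_integral_step (jump φ x 1) |x| (r := r) (abs_nonneg x)
  refine ⟨IntegrableOn.congr_fun (integrable_finsetSum _ fun x _ => (hint x).1) he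
    measurableSet_Ioc, ?_⟩
  rw [← setIntegral_congr_fun measurableSet_Ioc he,
    integral_finsetSum _ fun x _ => (hint x).1, hφ.second_difference hB hr (by linarith)]
  exact Finset.sum_congr rfl fun x _ => (hint x).2

/-- The pole number is the left derivative of the second difference. -/
theorem IsPiecewiseAffine.tendsto_poleNumber_neg {φ : ℝ → ℝ} (hφ : IsPiecewiseAffine φ)
    (hc : ConvexOn ℝ Set.univ φ) {t : ℝ} (ht : 0 < t) :
    Tendsto (fun k : ℕ => ((k : ℝ) + 1) * (φ t + φ (-t) - (φ (t - 1 / ((k : ℝ) + 1)) +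
      φ (-(t - 1 / ((k : ℝ) + 1)))))) atTop (𝓝 (poleNumber t fun s => -φ s)) := by
  obtain ⟨B, hB⟩ := hφ.exists_finset_jump (t + 1)
  rw [hφ.poleNumber_neg hc hB (by linarith)]
  -- The sequence is eventually constant: once the step is below `t - |x|` for every `x ∈ B` with
  -- `|x| < t`, the kernel of each such `x` is linear over the step, and every other kernel
  -- vanishes.
  refine tendsto_const_nhds.congr' ?_
  have h1 : ∀ δ : ℝ, 0 < δ → ∀ᶠ k : ℕ in atTop, 1 / ((k : ℝ) + 1) < δ := fun δ hδ =>
    tendsto_one_div_add_atTop_nhds_zero_nat.eventually (gt_mem_nhds hδ)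
  have h2 : ∀ᶠ k : ℕ in atTop, ∀ x ∈ B, |x| < t → 1 / ((k : ℝ) + 1) < t - |x| := by
    rw [eventually_all_finset]
    intro x _
    by_cases hx : |x| < t
    · filter_upwards [h1 _ (sub_pos.2 hx)] with k hk _ using hk
    · exact Eventually.of_forall fun k h => absurd h hx
  filter_upwards [h1 t ht, h2] with k hk1 hk2
  have hpos : (0 : ℝ) < 1 / ((k : ℝ) + 1) := by positivity
  have e1 := hφ.second_difference hB ht.le (by linarith)
  have e2 := hφ.second_difference hB (sub_nonneg.2 hk1.le) (by linarith)
  have e3 : φ t + φ (-t) - (φ (t - 1 / ((k : ℝ) + 1)) + φ (-(t - 1 / ((k : ℝ) + 1)))) =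
      ∑ x ∈ B, jump φ x 1 * (max (t - |x|) 0 - max (t - 1 / ((k : ℝ) + 1) - |x|) 0) := by
    simp only [mul_sub (jump φ _ 1), Finset.sum_sub_distrib]
    linarith
  rw [e3, Finset.mul_sum]
  refine Finset.sum_congr rfl fun x hx => ?_
  split_ifs with hxt
  · have := hk2 x hx hxt
    rw [max_eq_left (by linarith), max_eq_left (by linarith)]
    field_simp
    ring
  · push Not at hxt
    rw [max_eq_right (by linarith), max_eq_right (by linarith)]
    ring

/-! ## Convex functions that are piecewise affine on rays -/

section Convex

variable {n : ℕ}

/-- The surface measure of the unit sphere of `ℝⁿ`. -/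
abbrev surfaceMeasure (n : ℕ) : Measure (Metric.sphere (0 : EuclideanSpace ℝ (Fin n)) 1) :=
  (volume : Measure (EuclideanSpace ℝ (Fin n))).toSphere

/-- Convex functions that are piecewise affine on each line through the origin. -/
structure IsRadiallyPiecewiseAffine (u : EuclideanSpace ℝ (Fin n) → ℝ) : Prop where
  convex : ConvexOn ℝ Set.univ u
  radial : ∀ v : EuclideanSpace ℝ (Fin n), IsPiecewiseAffine fun t : ℝ => u (t • v)

/-! ### Tropical entire functions are convex and radially piecewise affine -/

/-- The term attaining the maximum at `z` is a supporting affine function there; this is what gives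
convexity. -/
theorem IsEntire.exists_support {u : EuclideanSpace ℝ (Fin n) → ℝ} (hu : IsEntire u)
    (z : EuclideanSpace ℝ (Fin n)) :
    ∃ (α : ℝ) (s : EuclideanSpace ℝ (Fin n)), u z = α + inner ℝ s z ∧ ∀ x, α + inner ℝ s x ≤ u
        x := by
  obtain ⟨a, s, h, -⟩ := hu
  obtain ⟨i, hi⟩ := (h z).1
  simp only at hi
  have hai : a i ≠ ⊥ := by
    rintro hb
    rw [hb, WithBot.bot_add] at hi
    exact WithBot.bot_ne_coe hi
  obtain ⟨α, hα⟩ := WithBot.ne_bot_iff_exists.1 hai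
  refine ⟨α, s i, ?_, fun x => ?_⟩
  · rw [← hα] at hi
    exact_mod_cast hi.symm
  · have := (h x).2 ⟨i, rfl⟩
    simp only [← hα] at this
    exact_mod_cast this

theorem IsEntire.convexOn {u : EuclideanSpace ℝ (Fin n) → ℝ} (hu : IsEntire u) : ConvexOn ℝ Set.univ
    u := by
  refine ⟨convex_univ, fun x _ y _ a b ha hb hab => ?_⟩
  obtain ⟨α, s, h1, h2⟩ := hu.exists_support (a • x + b • y)
  rw [h1, inner_add_right, inner_smul_right, inner_smul_right, smul_eq_mul, smul_eq_mul]
  have hx := mul_le_mul_of_nonneg_left (h2 x) ha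
  have hy := mul_le_mul_of_nonneg_left (h2 y) hb
  have : α = a * α + b * α := by rw [← add_mul, hab, one_mul]
  linarith

theorem IsEntire.exists_eq_sup' {u : EuclideanSpace ℝ (Fin n) → ℝ} (hu : IsEntire u) {R : ℝ}
    (hR : 0 ≤ R) :
    ∃ (F : Finset ℕ) (hF : F.Nonempty) (α : ℕ → ℝ) (s : ℕ → EuclideanSpace ℝ (Fin n)),
      ∀ x, ‖x‖ ≤ R → u x = F.sup' hF fun i => α i + inner ℝ (s i) x := by
  obtain ⟨a, s, h, hfin⟩ := hu
  obtain ⟨F, hF⟩ := hfin R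
  -- Terms with coefficient `-∞` are discarded, so the default value of `unbotD` never enters.
  have key : ∀ x, ‖x‖ ≤ R → ∃ i ∈ F.filter (fun i => a i ≠ ⊥),
      u x = (a i).unbotD 0 + inner ℝ (s i) x := by
    intro x hx
    obtain ⟨i, hi, he⟩ := hF x hx
    have hai : a i ≠ ⊥ := by
      rintro hb
      rw [hb, WithBot.bot_add] at he
      exact WithBot.coe_ne_bot he
    refine ⟨i, by simp [hi, hai], ?_⟩
    obtain ⟨α, hα⟩ := WithBot.ne_bot_iff_exists.1 hai
    rw [← hα] at he ⊢
    exact_mod_cast he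
  obtain ⟨i₀, hi₀, -⟩ := key 0 (by simpa using hR)
  refine ⟨_, ⟨i₀, hi₀⟩, fun i => (a i).unbotD 0, s, fun x hx => le_antisymm ?_ ?_⟩
  · obtain ⟨i, hi, he⟩ := key x hx
    rw [he]
    exact Finset.le_sup' (fun i => (a i).unbotD 0 + inner ℝ (s i) x) hi
  · refine Finset.sup'_le _ _ fun i hi => ?_
    obtain ⟨α, hα⟩ := WithBot.ne_bot_iff_exists.1 (Finset.mem_filter.1 hi).2
    have := (h x).2 ⟨i, rfl⟩
    simp only [← hα] at this ⊢
    exact_mod_cast this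

theorem IsEntire.isRadiallyPiecewiseAffine {u : EuclideanSpace ℝ (Fin n) → ℝ} (hu : IsEntire u) :
    IsRadiallyPiecewiseAffine u where
  convex := hu.convexOn
  radial v := by
    refine IsPiecewiseAffine.congr_local fun x => ?_
    obtain ⟨F, hF, α, s, h⟩ := hu.exists_eq_sup' (R := ‖x • v‖ + 1) (by positivity)
    refine ⟨_, IsPiecewiseAffine.finset_sup' F hF fun i _ =>
      IsPiecewiseAffine.of_eq (φ := fun t => α i + inner ℝ (s i) (t • v)) (α i) (inner ℝ (s i) v)
        fun t => by rw [inner_smul_right, mul_comm], ?_⟩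
    have hc : Continuous fun y : ℝ => ‖y • v‖ := by fun_prop
    filter_upwards [hc.continuousAt.eventually (gt_mem_nhds (lt_add_one ‖x • v‖))] with y hy
    exact h _ hy.le

namespace IsRadiallyPiecewiseAffine

variable {u w : EuclideanSpace ℝ (Fin n) → ℝ}

theorem const (c : ℝ) : IsRadiallyPiecewiseAffine fun _ : EuclideanSpace ℝ (Fin n) => c where
  convex := convexOn_const c convex_univ
  radial _ := .of_eq c 0 (by simp)

theorem add (hu : IsRadiallyPiecewiseAffine u) (hw : IsRadiallyPiecewiseAffine w) :
    IsRadiallyPiecewiseAffine fun x => u x + w x where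
  convex := hu.convex.add hw.convex
  radial v := (hu.radial v).add (hw.radial v)

theorem const_mul {c : ℝ} (hc : 0 ≤ c) (hu : IsRadiallyPiecewiseAffine u) :
    IsRadiallyPiecewiseAffine fun x => c * u x where
  convex := hu.convex.smul hc
  radial v := (hu.radial v).const_mul c

theorem sup (hu : IsRadiallyPiecewiseAffine u) (hw : IsRadiallyPiecewiseAffine w) :
    IsRadiallyPiecewiseAffine fun x => u x ⊔ w x where
  convex := hu.convex.sup hw.convex
  radial v := (hu.radial v).sup (hw.radial v)

theorem sum {ι : Type*} (s : Finset ι) {u : ι → EuclideanSpace ℝ (Fin n) → ℝ}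
    (h : ∀ i ∈ s, IsRadiallyPiecewiseAffine (u i)) :
    IsRadiallyPiecewiseAffine fun x => ∑ i ∈ s, u i x := by
  classical
  induction s using Finset.induction_on with
  | empty => simpa using const 0
  | insert a s ha ih =>
    simp only [Finset.sum_insert ha]
    exact (h a (by simp)).add (ih fun i hi => h i (by simp [hi]))

theorem finset_sup' {ι : Type*} (s : Finset ι) (hs : s.Nonempty)
    {u : ι → EuclideanSpace ℝ (Fin n) → ℝ}
    (h : ∀ i ∈ s, IsRadiallyPiecewiseAffine (u i)) :
    IsRadiallyPiecewiseAffine fun x => s.sup' hs fun i => u i x := by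
  classical
  induction hs using Finset.Nonempty.cons_induction with
  | singleton a => simpa using h a (by simp)
  | cons a s ha hs ih =>
    simp only [Finset.sup'_cons hs]
    exact (h a (by simp)).sup (ih fun i hi => h i (by simp [hi]))

theorem continuous (hu : IsRadiallyPiecewiseAffine u) : Continuous u :=
  continuousOn_univ.1 (hu.convex.continuousOn isOpen_univ)

theorem convex_radial (hu : IsRadiallyPiecewiseAffine u) (v : EuclideanSpace ℝ (Fin n)) :
    ConvexOn ℝ Set.univ fun t : ℝ => u (t • v) :=
  hu.convex.comp_linearMap (LinearMap.toSpanSingleton ℝ (EuclideanSpace ℝ (Fin n)) v)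

end IsRadiallyPiecewiseAffine

/-! ## Spherical means -/

/-- The surface measure of a set is defined through the volume of the cone over it, and volume is
invariant under negation. -/
theorem measurePreserving_neg_toSphere :
    MeasurePreserving (fun θ : Metric.sphere (0 : EuclideanSpace ℝ (Fin n)) 1 => -θ)
        (surfaceMeasure n) (surfaceMeasure n) := by
  have hm : Measurable fun θ : Metric.sphere (0 : EuclideanSpace ℝ (Fin n)) 1 => -θ :=
      continuous_neg.measurable
  refine ⟨hm, ?_⟩
  ext s hs
  rw [Measure.map_apply hm hs, Measure.toSphere_apply' _ hs, Measure.toSphere_apply' _ (hm hs)]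
  congr 1
  rw [← Measure.measure_neg]
  congr 1
  ext x
  simp only [Set.mem_neg, Set.mem_smul, Set.mem_image, Set.mem_preimage]
  constructor
  · rintro ⟨c, hc, _, ⟨θ, hθ, rfl⟩, he⟩
    refine ⟨c, hc, _, ⟨-θ, hθ, rfl⟩, ?_⟩
    rw [← neg_inj, ← he]
    simp
  · rintro ⟨c, hc, _, ⟨θ, hθ, rfl⟩, he⟩
    refine ⟨c, hc, _, ⟨-θ, by simpa using hθ, rfl⟩, ?_⟩
    rw [← he]
    simp

theorem integrable_radial {u : EuclideanSpace ℝ (Fin n) → ℝ} (hu : Continuous u) (r : ℝ) :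
    Integrable (fun θ : Metric.sphere (0 : EuclideanSpace ℝ (Fin n)) 1 => u
        (r • (θ : EuclideanSpace ℝ (Fin n)))) (surfaceMeasure n) := by
  have : Continuous fun θ : Metric.sphere (0 : EuclideanSpace ℝ (Fin n)) 1 => u
      (r • (θ : EuclideanSpace ℝ (Fin n))) := by fun_prop
  exact this.integrable_of_hasCompactSupport (HasCompactSupport.of_compactSpace _)

theorem sphereMean_eq (u : EuclideanSpace ℝ (Fin n) → ℝ) :
    sphereMean u = ((surfaceMeasure n).real Set.univ)⁻¹ * ∫ θ : Metric.sphere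
        (0 : EuclideanSpace ℝ (Fin n)) 1, u θ ∂surfaceMeasure n := by
  rw [sphereMean, average_eq, smul_eq_mul]

theorem sphereMean_neg_radial (u : EuclideanSpace ℝ (Fin n) → ℝ) (r : ℝ) :
    sphereMean (fun θ : EuclideanSpace ℝ (Fin n) => u (-r • θ)) = sphereMean fun θ : EuclideanSpace
        ℝ (Fin n) => u (r • θ) := by
  rw [sphereMean_eq, sphereMean_eq]
  congr 1
  have := (measurePreserving_neg_toSphere (n := n)).integral_comp
    (Homeomorph.neg _).measurableEmbedding
    (fun θ : Metric.sphere (0 : EuclideanSpace ℝ (Fin n)) 1 => u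
        (r • (θ : EuclideanSpace ℝ (Fin n))))
  rw [← this]
  simp

/-- Dimension at least 1 is essential: in dimension 0 the sphere is empty and every mean is 0. -/
theorem sphereMean_const (hn : 1 ≤ n) (c : ℝ) : sphereMean (fun _ : EuclideanSpace ℝ (Fin n) => c) =
    c := by
  have : Nonempty (Fin n) := ⟨⟨0, hn⟩⟩
  have : NeZero (surfaceMeasure n) := ⟨Measure.toSphere_ne_zero _⟩
  rw [sphereMean, average_const]

theorem sphereMean_add {u w : EuclideanSpace ℝ (Fin n) → ℝ}
    (hu : Integrable (fun θ : Metric.sphere (0 : EuclideanSpace ℝ (Fin n)) 1 => u θ)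
        (surfaceMeasure n))
    (hw : Integrable (fun θ : Metric.sphere (0 : EuclideanSpace ℝ (Fin n)) 1 => w θ)
        (surfaceMeasure n)) :
    sphereMean (fun θ => u θ + w θ) = sphereMean u + sphereMean w := by
  rw [sphereMean_eq, sphereMean_eq, sphereMean_eq, integral_add hu hw, mul_add]

theorem sphereMean_const_mul (c : ℝ) (u : EuclideanSpace ℝ (Fin n) → ℝ) :
    sphereMean (fun θ => c * u θ) = c * sphereMean u := by
  rw [sphereMean_eq, sphereMean_eq, integral_const_mul]
  ring

theorem sphereMean_mono {u w : EuclideanSpace ℝ (Fin n) → ℝ}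
    (hu : Integrable (fun θ : Metric.sphere (0 : EuclideanSpace ℝ (Fin n)) 1 => u θ)
        (surfaceMeasure n))
    (hw : Integrable (fun θ : Metric.sphere (0 : EuclideanSpace ℝ (Fin n)) 1 => w θ)
        (surfaceMeasure n))
    (h : ∀ θ, u θ ≤ w θ) : sphereMean u ≤ sphereMean w := by
  rw [sphereMean_eq, sphereMean_eq]
  exact mul_le_mul_of_nonneg_left (integral_mono hu hw fun θ => h θ) (by positivity)

theorem sphereMean_nonneg {u : EuclideanSpace ℝ (Fin n) → ℝ} (h : ∀ θ, 0 ≤ u θ) : 0 ≤ sphereMean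
    u := by
  rw [sphereMean_eq]
  exact mul_nonneg (by positivity) (integral_nonneg fun θ => h θ)

/-- The mean of the symmetric second difference at the origin. -/
theorem sphereMean_second_difference (hn : 1 ≤ n) {u : EuclideanSpace ℝ (Fin n) → ℝ}
    (hu : Continuous u) (r : ℝ) :
    sphereMean (fun θ : EuclideanSpace ℝ (Fin n) => u (r • θ) + u (-r • θ) - 2 * u 0) =
      2 * (sphereMean (fun θ : EuclideanSpace ℝ (Fin n) => u (r • θ)) - u 0) := by
  simp only [sub_eq_add_neg]
  rw [sphereMean_add ((integrable_radial hu r).add (integrable_radial hu (-r)))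
    (integrable_const _), sphereMean_add (integrable_radial hu r) (integrable_radial hu (-r)),
    sphereMean_neg_radial, sphereMean_const hn]
  ring

/-! ## The Jensen formula -/

/-- For `t > 0` the pole number is a pointwise limit of the continuous difference quotients `D k`,
and for `t ≤ 0` it is 0. Joint measurability is what Fubini needs. -/
theorem IsRadiallyPiecewiseAffine.aestronglyMeasurable_poleNumber {u : EuclideanSpace ℝ (Fin n) → ℝ}
    (hu : IsRadiallyPiecewiseAffine u)
        (μ : Measure (ℝ × Metric.sphere (0 : EuclideanSpace ℝ (Fin n)) 1)) :
    AEStronglyMeasurable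
      (fun p : ℝ × Metric.sphere (0 : EuclideanSpace ℝ (Fin n)) 1 => poleNumber p.1 fun s => -u
          (s • (p.2 : EuclideanSpace ℝ (Fin n)))) μ := by
  have hc := hu.continuous
  let D : ℕ → ℝ × Metric.sphere (0 : EuclideanSpace ℝ (Fin n)) 1 → ℝ := fun k p =>
    ((k : ℝ) + 1) * (u (p.1 • (p.2 : EuclideanSpace ℝ (Fin n))) + u
        (-p.1 • (p.2 : EuclideanSpace ℝ (Fin n))) -
      (u ((p.1 - 1 / ((k : ℝ) + 1)) • (p.2 : EuclideanSpace ℝ (Fin n))) + u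
          (-(p.1 - 1 / ((k : ℝ) + 1)) • (p.2 : EuclideanSpace ℝ (Fin n)))))
  have hD : ∀ k, Continuous (D k) := fun k => by fun_prop
  have hS : MeasurableSet {p : ℝ × Metric.sphere (0 : EuclideanSpace ℝ (Fin n)) 1 | 0 < p.1} :=
    measurableSet_lt measurable_const measurable_fst
  have hm : Measurable
      (fun p : ℝ × Metric.sphere (0 : EuclideanSpace ℝ (Fin n)) 1 => poleNumber p.1 fun s => -u
          (s • (p.2 : EuclideanSpace ℝ (Fin n)))) := by
    refine measurable_of_tendsto_metrizable
      (f := fun k => {p : ℝ × Metric.sphere (0 : EuclideanSpace ℝ (Fin n)) 1 | 0 < p.1}.indicator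
          (D k))
      (fun k => (hD k).measurable.indicator hS) ?_
    rw [tendsto_pi_nhds]
    intro p
    by_cases hp : 0 < p.1
    · exact ((hu.radial p.2).tendsto_poleNumber_neg (hu.convex_radial p.2) hp).congr fun k =>
        (Set.indicator_of_mem (s := {p : ℝ × Metric.sphere (0 : EuclideanSpace ℝ (Fin n)) 1 |
          0 < p.1}) hp (D k)).symm
    · simp [hp, poleNumber_of_nonpos (not_lt.1 hp)]
  exact hm.aestronglyMeasurable

/-- The Jensen formula. -/
theorem IsRadiallyPiecewiseAffine.countingFun_neg (hn : 1 ≤ n) {u : EuclideanSpace ℝ (Fin n) → ℝ}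
    (hu : IsRadiallyPiecewiseAffine u) {r : ℝ} (hr : 0 ≤ r) :
    countingFun r (fun x => -u x) = sphereMean (fun θ : EuclideanSpace ℝ (Fin n) => u (r • θ)) - u
        0 := by
  have hJ := fun v : EuclideanSpace ℝ (Fin n) => (hu.radial v).integral_poleNumber_neg
      (hu.convex_radial v) hr
  have hW : Integrable (fun θ : Metric.sphere (0 : EuclideanSpace ℝ (Fin n)) 1 =>
      u (r • (θ : EuclideanSpace ℝ (Fin n))) + u (-r • (θ : EuclideanSpace ℝ (Fin n))) - 2 * u 0)
          (surfaceMeasure n) :=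
    ((integrable_radial hu.continuous r).add (integrable_radial hu.continuous (-r))).sub
      (integrable_const _)
  have hint : Integrable (fun p : ℝ × Metric.sphere (0 : EuclideanSpace ℝ (Fin n)) 1 =>
      poleNumber p.1 fun s => -u (s • (p.2 : EuclideanSpace ℝ (Fin n))))
          ((volume.restrict (Set.Ioc 0 r)).prod (surfaceMeasure n)) := by
    -- The integrand is nonnegative, so its norm integrates in `t` to the second difference of `u`,
    -- which is continuous in `θ`.
    rw [integrable_prod_iff' (hu.aestronglyMeasurable_poleNumber _)]
    refine ⟨Eventually.of_forall fun θ => (hJ θ).1, ?_⟩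
    refine hW.congr (Eventually.of_forall fun θ => ?_)
    simp only [Real.norm_of_nonneg (poleNumber_nonneg _ _)]
    simpa using (hJ θ).2.symm
  have h1 : ∫ t in (0 : ℝ)..r, meanPoleNumber t (fun x => -u x) =
      sphereMean (fun θ : EuclideanSpace ℝ (Fin n) => u (r • θ) + u (-r • θ) - 2 * u 0) := by
    rw [intervalIntegral.integral_of_le hr, sphereMean_eq]
    simp only [meanPoleNumber, sphereMean_eq]
    rw [integral_const_mul, integral_integral_swap hint]
    congr 2
    funext θ
    simpa using (hJ θ).2
  rw [countingFun, h1, sphereMean_second_difference hn hu.continuous]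
  ring

theorem countingFun_nonneg (u : EuclideanSpace ℝ (Fin n) → ℝ) {r : ℝ} (hr : 0 ≤ r) : 0 ≤ countingFun
    r u :=
  mul_nonneg (by norm_num) (intervalIntegral.integral_nonneg hr fun _ _ =>
    sphereMean_nonneg fun _ => poleNumber_nonneg _ _)

/-! ## Growth of spherical means of convex functions -/

/-- `x` is the convex combination of `t • x` and `0` with weight `1 / t` on the former. -/
theorem _root_.ConvexOn.smul_sub_le {u : EuclideanSpace ℝ (Fin n) → ℝ} (hu : ConvexOn ℝ Set.univ u)
    {t : ℝ}
    (ht : 1 ≤ t) (x : EuclideanSpace ℝ (Fin n)) : t * (u x - u 0) ≤ u (t • x) - u 0 := by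
  have ht0 : 0 < t := by linarith
  have h := hu.2 (Set.mem_univ (t • x)) (Set.mem_univ 0) (inv_nonneg.2 ht0.le)
    (sub_nonneg.2 (inv_le_one_of_one_le₀ ht)) (add_sub_cancel _ _)
  rw [smul_zero, add_zero, smul_smul, inv_mul_cancel₀ ht0.ne', one_smul, smul_eq_mul,
    smul_eq_mul] at h
  have h2 := mul_le_mul_of_nonneg_left h ht0.le
  have e : t * (t⁻¹ * u (t • x) + (1 - t⁻¹) * u 0) = u (t • x) + (t - 1) * u 0 := by
    field_simp
  linarith

theorem _root_.ConvexOn.two_mul_le_add_neg {u : EuclideanSpace ℝ (Fin n) → ℝ}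
    (hu : ConvexOn ℝ Set.univ u) (x : EuclideanSpace ℝ (Fin n)) :
    2 * u 0 ≤ u x + u (-x) := by
  have h := hu.2 (Set.mem_univ x) (Set.mem_univ (-x)) (by norm_num : (0 : ℝ) ≤ 1 / 2)
    (by norm_num : (0 : ℝ) ≤ 1 / 2) (by norm_num)
  rw [smul_neg, add_neg_cancel, smul_eq_mul, smul_eq_mul] at h
  linarith

/-- A convex function dominated by a convex function that is odd up to a constant differs from it
by a constant. -/
theorem sub_eq_sub_of_le {u g : EuclideanSpace ℝ (Fin n) → ℝ} (hu : ConvexOn ℝ Set.univ u)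
    (hg : ConvexOn ℝ Set.univ g) (hle : ∀ x, u x ≤ g x) (hodd : ∀ x, g x + g (-x) = 2 * g 0)
    (x : EuclideanSpace ℝ (Fin n)) : u x - u 0 = g x - g 0 := by
  have key : ∀ x, u x - u 0 ≤ g x - g 0 := by
    intro x
    by_contra! hlt
    set δ := (u x - u 0) - (g x - g 0) with hδ
    have hδ0 : 0 < δ := by linarith
    -- Along the ray through `x`, `u` grows at least linearly and the oddness of `g` makes `g` grow
    -- at most linearly. The excess `δ` is thus multiplied by `t` and overtakes the initial gap `g 0
    -- - u 0`.
    obtain ⟨t, ht⟩ := exists_gt (max 1 ((g 0 - u 0) / δ))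
    have ht1 : 1 ≤ t := (le_max_left _ _).trans ht.le
    have ht2 : g 0 - u 0 < t * δ := (div_lt_iff₀ hδ0).1 ((le_max_right _ _).trans_lt ht)
    have h1 := hu.smul_sub_le ht1 x
    have h2 := hg.smul_sub_le ht1 (-x)
    have h3 := hle (t • x)
    have h4 := hodd (t • x)
    have h5 := hodd x
    rw [smul_neg] at h2
    have h6 : g (-x) = 2 * g 0 - g x := by linarith
    rw [h6] at h2
    have h7 : t * δ = t * (u x - u 0) - t * (g x - g 0) := by rw [hδ]; ring
    have h8 : t * (2 * g 0 - g x - g 0) = -(t * (g x - g 0)) := by ring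
    linarith
  refine le_antisymm (key x) ?_
  -- The reverse inequality comes from `key` at `-x`, the oddness of `g` and midpoint convexity of
  -- `u`.
  linarith [key (-x), hodd x, hu.two_mul_le_add_neg x]

theorem sphereMean_sub_nonneg (hn : 1 ≤ n) {u : EuclideanSpace ℝ (Fin n) → ℝ}
    (hu : ConvexOn ℝ Set.univ u)
    (hc : Continuous u) (r : ℝ) : 0 ≤ sphereMean (fun θ : EuclideanSpace ℝ (Fin n) => u (r • θ)) - u
        0 := by
  have h : 0 ≤ sphereMean (fun θ : EuclideanSpace ℝ (Fin n) => u (r • θ) + u (-r • θ) - 2 * u 0) :=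
    sphereMean_nonneg fun θ => by
      have := hu.two_mul_le_add_neg (r • θ)
      rw [neg_smul]; linarith
  rw [sphereMean_second_difference hn hc] at h
  linarith

theorem mul_sphereMean_sub_le (hn : 1 ≤ n) {u : EuclideanSpace ℝ (Fin n) → ℝ}
    (hu : ConvexOn ℝ Set.univ u)
    (hc : Continuous u) (r : ℝ) {t : ℝ} (ht : 1 ≤ t) :
    t * (sphereMean (fun θ : EuclideanSpace ℝ (Fin n) => u (r • θ)) - u 0) ≤
      sphereMean (fun θ : EuclideanSpace ℝ (Fin n) => u ((t * r) • θ)) - u 0 := by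
  have hi : ∀ r, Integrable (fun θ : Metric.sphere (0 : EuclideanSpace ℝ (Fin n)) 1 => u
      (r • (θ : EuclideanSpace ℝ (Fin n))) + -u 0) (surfaceMeasure n) :=
    fun r => (integrable_radial hc r).add (integrable_const _)
  have he : ∀ r, sphereMean (fun θ : EuclideanSpace ℝ (Fin n) => u (r • θ)) - u 0 =
      sphereMean (fun θ : EuclideanSpace ℝ (Fin n) => u (r • θ) + -u 0) := fun r => by
    rw [sphereMean_add (integrable_radial hc r) (integrable_const _), sphereMean_const hn,
      sub_eq_add_neg]
  rw [he, he, ← sphereMean_const_mul]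
  refine sphereMean_mono ((hi r).const_mul t) (hi _) fun θ => ?_
  have := hu.smul_sub_le ht (r • θ)
  rw [smul_smul] at this
  simpa only [sub_eq_add_neg] using this

/-- The symmetric second difference is continuous and nonnegative on each sphere, with mean zero;
since surface measure charges nonempty open sets, it vanishes identically. -/
theorem odd_of_sphereMean_eq (hn : 1 ≤ n) {u : EuclideanSpace ℝ (Fin n) → ℝ}
    (hu : ConvexOn ℝ Set.univ u)
    (hc : Continuous u) (h : ∀ r : ℝ, 0 < r → sphereMean
        (fun θ : EuclideanSpace ℝ (Fin n) => u (r • θ)) - u 0 = 0) (x : EuclideanSpace ℝ (Fin n)) :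
    u x + u (-x) = 2 * u 0 := by
  rcases eq_or_ne x 0 with rfl | hx
  · rw [neg_zero]; ring
  have hr : 0 < ‖x‖ := norm_pos_iff.2 hx
  have h0 : sphereMean (fun θ : EuclideanSpace ℝ (Fin n) => u (‖x‖ • θ) + u (-‖x‖ • θ) - 2 * u 0) =
      0 := by
    rw [sphereMean_second_difference hn hc, h _ hr, mul_zero]
  have : Nonempty (Fin n) := ⟨⟨0, hn⟩⟩
  have hvol : (surfaceMeasure n).real Set.univ ≠ 0 := by
    rw [Measure.real, ENNReal.toReal_ne_zero]
    exact ⟨Measure.measure_univ_ne_zero.2 (Measure.toSphere_ne_zero _), measure_ne_top _ _⟩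
  rw [sphereMean_eq] at h0
  have h1 := (mul_eq_zero.1 h0).resolve_left (inv_ne_zero hvol)
  have hcont : Continuous fun θ : Metric.sphere (0 : EuclideanSpace ℝ (Fin n)) 1 =>
      u (‖x‖ • (θ : EuclideanSpace ℝ (Fin n))) + u (-‖x‖ • (θ : EuclideanSpace ℝ (Fin n))) - 2 * u
          0 := by fun_prop
  have h2 := (Continuous.integral_pos_of_hasCompactSupport_nonneg_nonzero (μ := surfaceMeasure n)
      hcont
    (HasCompactSupport.of_compactSpace _) (fun θ => by
      have := hu.two_mul_le_add_neg (‖x‖ • (θ : EuclideanSpace ℝ (Fin n)))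
      simp only [Pi.zero_apply, neg_smul]; linarith)
    (x := ⟨‖x‖⁻¹ • x, by simp [norm_smul, hr.ne']⟩)).mt
  by_contra hne
  refine h2 h1.not_gt ?_
  simp only [smul_smul, neg_mul, mul_inv_cancel₀ hr.ne', neg_smul, one_smul]
  intro h3
  exact hne (by linarith)

end Convex

/-! ## Homogeneous tropical polynomials -/

namespace HomPoly

variable {m d : ℕ}

theorem sum_multiIndex (I : MultiIndex m d) : ∑ k, ((I : Fin (m + 1) → ℕ) k : ℝ) = d := by
  exact_mod_cast (Finset.mem_piAntidiag.1 I.2).1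

/-- The multi-index of the monomial `x_k ^ d`. -/
def powIndex (m d : ℕ) (k : Fin (m + 1)) : MultiIndex m d :=
  ⟨Pi.single k d, Finset.mem_piAntidiag.2 ⟨by simp, fun _ _ => Finset.mem_univ _⟩⟩

theorem term_powIndex (P : HomPoly m d) (k : Fin (m + 1)) (x : Fin (m + 1) → ℝ) :
    P.term (powIndex m d k) x = (P.coeff (powIndex m d k)).unbotD 0 + d * x k := by
  rw [term, Finset.sum_eq_single k]
  · simp [powIndex]
  · intro b _ hb
    simp [powIndex, hb]
  · simp

theorem term_le (P : HomPoly m d) {I : MultiIndex m d} (hI : I ∈ P.support)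
    (x : Fin (m + 1) → ℝ) :
    P.term I x ≤ d * Finset.univ.sup' Finset.univ_nonempty x + P.coeffNorm := by
  have h1 : (P.coeff I).unbotD 0 ≤ P.coeffNorm :=
    Finset.le_sup' (fun I => (P.coeff I).unbotD 0) hI
  have h2 : ∑ k, ((I : Fin (m + 1) → ℕ) k : ℝ) * x k ≤
      d * Finset.univ.sup' Finset.univ_nonempty x := by
    rw [← sum_multiIndex I, Finset.sum_mul]
    exact Finset.sum_le_sum fun k hk =>
      mul_le_mul_of_nonneg_left (Finset.le_sup' x hk) (Nat.cast_nonneg _)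
  rw [term]; linarith

theorem eval_le (P : HomPoly m d) (x : Fin (m + 1) → ℝ) :
    P.eval x ≤ d * Finset.univ.sup' Finset.univ_nonempty x + P.coeffNorm :=
  Finset.sup'_le _ _ fun _ hI => P.term_le hI x

theorem card_multiIndex (m d : ℕ) : Fintype.card (MultiIndex m d) = (m + d).choose d := by
  rw [Fintype.card_coe, ← Finset.map_sym_eq_piAntidiag, Finset.card_map, Finset.sym_univ,
    Finset.card_univ, Sym.card_sym_eq_choose, Fintype.card_fin]
  congr 1
  omega

/-- If every coefficient is finite, then `P(x)` differs from `d max_i x_i` by a bounded amount. -/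
theorem exists_le_eval (P : HomPoly m d) (h : P.support = Finset.univ) :
    ∃ c : ℝ, ∀ x, d * Finset.univ.sup' Finset.univ_nonempty x + c ≤ P.eval x := by
  -- The constant is the least coefficient of a pure power `x_k ^ d`; the power of a largest
  -- coordinate gives the bound.
  refine ⟨Finset.univ.inf' Finset.univ_nonempty fun k => (P.coeff (powIndex m d k)).unbotD 0,
    fun x => ?_⟩
  obtain ⟨k, hk, he⟩ := Finset.exists_mem_eq_sup' (Finset.univ_nonempty (α := Fin (m + 1))) x
  have h1 : P.term (powIndex m d k) x ≤ P.eval x :=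
    Finset.le_sup' (fun I => P.term I x) (by rw [h]; exact Finset.mem_univ _)
  have h2 := Finset.inf'_le (fun k => (P.coeff (powIndex m d k)).unbotD 0) hk
  rw [term_powIndex] at h1
  rw [he]
  linarith

end HomPoly

/-! ## Characteristic and proximity functions -/

namespace HolomorphicMap

variable {n m : ℕ} (f : HolomorphicMap n m)

theorem isRadiallyPiecewiseAffine_maxNorm : IsRadiallyPiecewiseAffine f.maxNorm :=
  .finset_sup' _ _ fun i _ => (f.entire i).isRadiallyPiecewiseAffine

theorem isRadiallyPiecewiseAffine_polyComp {d : ℕ} (P : HomPoly m d) :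
    IsRadiallyPiecewiseAffine (f.polyComp P) :=
  .finset_sup' P.support P.support_nonempty fun _ _ => (IsRadiallyPiecewiseAffine.const _).add <|
    .sum _ fun k _ => (f.entire k).isRadiallyPiecewiseAffine.const_mul (Nat.cast_nonneg _)

theorem charFun_nonneg (hn : 1 ≤ n) (r : ℝ) : 0 ≤ f.charFun r :=
  sphereMean_sub_nonneg hn f.isRadiallyPiecewiseAffine_maxNorm.convex
    f.isRadiallyPiecewiseAffine_maxNorm.continuous r

/-- An algebraically nondegenerate map has a nonconstant characteristic function. -/
theorem AlgNondegenerate.exists_charFun_pos {f : HolomorphicMap n m} (hn : 1 ≤ n) (hm : 1 ≤ m)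
    (hf : f.AlgNondegenerate) : ∃ r, 0 < r ∧ 0 < f.charFun r := by
  by_contra! hle
  have hg := f.isRadiallyPiecewiseAffine_maxNorm
  have hodd := odd_of_sphereMean_eq hn hg.convex hg.continuous fun r hr =>
    le_antisymm (hle r hr) (f.charFun_nonneg hn r)
  have hcomp : ∀ i x, f.comp i x - f.comp i 0 = f.maxNorm x - f.maxNorm 0 := fun i =>
    sub_eq_sub_of_le (f.entire i).convexOn hg.convex
      (fun x => Finset.le_sup' (f.point x) (Finset.mem_univ i)) hodd
  let k₁ : Fin (m + 1) := ⟨1, by omega⟩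
  let e : Fin (m + 1) → MultiIndex m 1 := HomPoly.powIndex m 1
  have hne : e 0 ≠ e k₁ := by
    intro h
    have h1 := congrFun (congrArg Subtype.val h) 0
    have h2 : (0 : Fin (m + 1)) ≠ k₁ := by simp [k₁, Fin.ext_iff]
    simp [e, HomPoly.powIndex, h2] at h1
  -- The linear form `max (x_0 - f_0(0), x_1 - f_1(0))`. Along `f` both terms equal `‖f(x)‖ -
  -- ‖f(0)‖`, so the maximum is always attained twice, contradicting nondegeneracy in degree 1.
  let c : MultiIndex m 1 → WithBot ℝ := fun I =>
    if I = e 0 then ((-f.comp 0 0 : ℝ) : WithBot ℝ)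
    else if I = e k₁ then ((-f.comp k₁ 0 : ℝ) : WithBot ℝ) else ⊥
  have hc0 : c (e 0) = ((-f.comp 0 0 : ℝ) : WithBot ℝ) := by simp [c]
  have hc1 : c (e k₁) = ((-f.comp k₁ 0 : ℝ) : WithBot ℝ) := by simp [c, hne.symm]
  let P : HomPoly m 1 := ⟨c, e 0, by rw [hc0]; exact WithBot.coe_ne_bot⟩
  have hs0 : e 0 ∈ P.support := Finset.mem_filter.2 ⟨Finset.mem_univ _, by
    change c (e 0) ≠ ⊥
    rw [hc0]; exact WithBot.coe_ne_bot⟩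
  have hs1 : e k₁ ∈ P.support := Finset.mem_filter.2 ⟨Finset.mem_univ _, by
    change c (e k₁) ≠ ⊥
    rw [hc1]; exact WithBot.coe_ne_bot⟩
  have ht0 : ∀ x, P.term (e 0) (f.point x) = f.maxNorm x - f.maxNorm 0 := fun x => by
    rw [HomPoly.term_powIndex, ← hcomp 0 x]
    change (c (e 0)).unbotD 0 + _ = _
    rw [hc0, WithBot.unbotD_coe, point]
    push_cast
    ring
  have ht1 : ∀ x, P.term (e k₁) (f.point x) = f.maxNorm x - f.maxNorm 0 := fun x => by
    rw [HomPoly.term_powIndex, ← hcomp k₁ x]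
    change (c (e k₁)).unbotD 0 + _ = _
    rw [hc1, WithBot.unbotD_coe, point]
    push_cast
    ring
  have hterm : ∀ x, ∀ I ∈ P.support, P.term I (f.point x) = f.maxNorm x - f.maxNorm 0 := by
    intro x I hI
    have hI' : c I ≠ ⊥ := (Finset.mem_filter.1 hI).2
    by_cases h0 : I = e 0
    · rw [h0, ht0]
    by_cases h1 : I = e k₁
    · rw [h1, ht1]
    · simp [c, h0, h1] at hI'
  refine hf 1 le_rfl P ?_
  rintro _ ⟨x, rfl⟩
  have heval : P.eval (f.point x) = f.maxNorm x - f.maxNorm 0 :=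
    le_antisymm (Finset.sup'_le _ _ fun I hI => (hterm x I hI).le)
      ((ht0 x).ge.trans (Finset.le_sup' (fun I => P.term I (f.point x)) hs0))
  exact ⟨e 0, hs0, e k₁, hs1, hne, by rw [ht0, heval], by rw [ht1, heval]⟩

/-- Convexity turns one positive value of `T` into at least linear growth. -/
theorem AlgNondegenerate.tendsto_charFun {f : HolomorphicMap n m} (hn : 1 ≤ n) (hm : 1 ≤ m)
    (hf : f.AlgNondegenerate) : Tendsto f.charFun atTop atTop := by
  obtain ⟨r, hr, hT⟩ := hf.exists_charFun_pos hn hm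
  have hg := f.isRadiallyPiecewiseAffine_maxNorm
  have h1 : Tendsto (fun s : ℝ => s / r * f.charFun r) atTop atTop :=
    (tendsto_id.atTop_div_const hr).atTop_mul_const hT
  refine tendsto_atTop_mono' _ ?_ h1
  filter_upwards [eventually_ge_atTop r] with s hs
  have := mul_sphereMean_sub_le hn hg.convex hg.continuous r ((one_le_div hr).2 hs)
  rwa [div_mul_cancel₀ _ hr.ne'] at this

theorem weil_nonneg {d : ℕ} (P : HomPoly m d) (x : EuclideanSpace ℝ (Fin n)) :
    0 ≤ f.weil P x :=
  sub_nonneg.2 (P.eval_le (f.point x))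

theorem proximity_nonneg {d : ℕ} (P : HomPoly m d) (r : ℝ) : 0 ≤ f.proximity P r :=
  sphereMean_nonneg fun _ => f.weil_nonneg P _

theorem continuous_weil {d : ℕ} (P : HomPoly m d) : Continuous (f.weil P) :=
  ((f.isRadiallyPiecewiseAffine_maxNorm.continuous.const_mul _).add_const _).sub
    (f.isRadiallyPiecewiseAffine_polyComp P).continuous

/-- The first main theorem. -/
theorem proximity_add_countingFun (hn : 1 ≤ n) {d : ℕ} (P : HomPoly m d) {r : ℝ} (hr : 0 ≤ r) :
    f.proximity P r + countingFun r (fun x => -f.polyComp P x) =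
      d * f.charFun r + f.weil P 0 := by
  have hP := f.isRadiallyPiecewiseAffine_polyComp P
  have h : sphereMean (fun θ : EuclideanSpace ℝ (Fin n) => f.weil P (r • θ) +
      f.polyComp P (r • θ)) = sphereMean fun θ : EuclideanSpace ℝ (Fin n) =>
        d * f.maxNorm (r • θ) + P.coeffNorm := by
    simp only [weil, sub_add_cancel]
  have hg := integrable_radial f.isRadiallyPiecewiseAffine_maxNorm.continuous r
  rw [sphereMean_add (u := fun θ => f.weil P (r • θ)) (w := fun θ => f.polyComp P (r • θ))
      (integrable_radial (f.continuous_weil P) r) (integrable_radial hP.continuous r),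
    sphereMean_add (u := fun θ => d * f.maxNorm (r • θ)) (w := fun _ => P.coeffNorm)
      (hg.const_mul _) (integrable_const _), sphereMean_const_mul, sphereMean_const hn] at h
  -- Jensen replaces the counting function by the mean of `P ∘ f` minus its value at 0; the
  -- constants collect into the Weil function at the origin.
  rw [hP.countingFun_neg hn hr, proximity, charFun, weil]
  linarith

/-- `P` itself competes in the infimum defining the shortest length, so it cannot have fewer
monomials. -/
theorem IsComplete.support_eq_univ {f : HolomorphicMap n m} {d : ℕ} {P : HomPoly m d}
    (h : f.IsComplete P) : P.support = Finset.univ := by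
  have h1 : f.shortestLength d (f.polyComp P) ≤ P.support.card := Nat.sInf_le ⟨P, rfl, rfl⟩
  rw [h, ← HomPoly.card_multiIndex] at h1
  exact (Finset.card_eq_iff_eq_univ _).1 (le_antisymm (Finset.card_le_univ _) h1)

theorem IsComplete.exists_proximity_le {f : HolomorphicMap n m} (hn : 1 ≤ n) {d : ℕ}
    {P : HomPoly m d} (h : f.IsComplete P) : ∃ C, ∀ r, f.proximity P r ≤ C := by
  obtain ⟨c, hc⟩ := P.exists_le_eval h.support_eq_univ
  refine ⟨P.coeffNorm - c, fun r => ?_⟩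
  rw [← sphereMean_const hn (P.coeffNorm - c)]
  refine sphereMean_mono (integrable_radial (f.continuous_weil P) r) (integrable_const _)
    fun θ => ?_
  have : d * f.maxNorm (r • θ) + c ≤ f.polyComp P (r • θ) := hc (f.point (r • θ))
  rw [weil]; linarith

end HolomorphicMap

/-! ## Defects -/

theorem limsup_add_of_tendsto_zero {v w : ℝ → ℝ} (hv : IsBoundedUnder (· ≤ ·) atTop v)
    (hv' : IsBoundedUnder (· ≥ ·) atTop v) (hw : Tendsto w atTop (𝓝 0)) :
    limsup (v + w) atTop = limsup v atTop := by
  have hw1 := hw.isBoundedUnder_le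
  have hw2 := hw.isBoundedUnder_ge
  refine le_antisymm ?_ ?_
  · have := limsup_add_le hv' hv hw2.isCoboundedUnder_le hw1
    rwa [hw.limsup_eq, add_zero] at this
  · have := le_limsup_add hv hv'.isCoboundedUnder_le hw1 hw2
    rwa [hw.liminf_eq, add_zero] at this

namespace HolomorphicMap

variable {n m : ℕ} {f : HolomorphicMap n m}

theorem AlgNondegenerate.tendsto_const_div (hn : 1 ≤ n) (hm : 1 ≤ m) (hf : f.AlgNondegenerate)
    {d : ℕ} (hd : 1 ≤ d) (C : ℝ) : Tendsto (fun r => C / (d * f.charFun r)) atTop (𝓝 0) :=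
  ((hf.tendsto_charFun hn hm).const_mul_atTop (by exact_mod_cast hd)).const_div_atTop C

/-- The two bounds make the real-valued `limsup` meaningful; the identity is the first main theorem
divided by `d T`. -/
theorem AlgNondegenerate.eventually_ratio_mem (hn : 1 ≤ n) (hm : 1 ≤ m)
    (hf : f.AlgNondegenerate) {d : ℕ} (hd : 1 ≤ d) (P : HomPoly m d) :
    ∀ᶠ r in atTop, 0 ≤ countingFun r (fun x => -f.polyComp P x) / (d * f.charFun r) ∧
      countingFun r (fun x => -f.polyComp P x) / (d * f.charFun r) ≤ 2 ∧
      f.proximity P r / (d * f.charFun r) =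
        1 - (countingFun r (fun x => -f.polyComp P x) / (d * f.charFun r) +
          -f.weil P 0 / (d * f.charFun r)) := by
  have hd' : (0 : ℝ) < d := by exact_mod_cast hd
  filter_upwards [(hf.tendsto_charFun hn hm).eventually_gt_atTop 0, eventually_ge_atTop 0,
    -- Since the proximity function is nonnegative, the ratio is at most `1 + weil(0) / (d T)`,
    -- which is eventually below 2.
    (hf.tendsto_const_div hn hm hd (f.weil P 0)).eventually (gt_mem_nhds one_pos)]
    with r hT hr hw
  have hpos : 0 < d * f.charFun r := mul_pos hd' hT
  have h1 := f.proximity_add_countingFun hn P hr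
  have he : f.proximity P r / (d * f.charFun r) =
      1 - (countingFun r (fun x => -f.polyComp P x) / (d * f.charFun r) +
        -f.weil P 0 / (d * f.charFun r)) := by
    rw [eq_sub_of_add_eq h1]
    field_simp
    ring
  have hp : 0 ≤ f.proximity P r / (d * f.charFun r) :=
    div_nonneg (f.proximity_nonneg P r) hpos.le
  refine ⟨div_nonneg (countingFun_nonneg _ hr) hpos.le, ?_, he⟩
  rw [he, neg_div] at hp
  linarith

theorem AlgNondegenerate.defect_eq (hn : 1 ≤ n) (hm : 1 ≤ m) (hf : f.AlgNondegenerate) {d : ℕ}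
    (hd : 1 ≤ d) (P : HomPoly m d) : f.defect P =
      1 - limsup (fun r : ℝ => countingFun r (fun x => -f.polyComp P x) / (d * f.charFun r))
        atTop := by
  have h := hf.eventually_ratio_mem hn hm hd P
  set v := fun r : ℝ => countingFun r (fun x => -f.polyComp P x) / (d * f.charFun r) with hv
  have hw := hf.tendsto_const_div hn hm hd (-f.weil P 0)
  have hv1 : IsBoundedUnder (· ≤ ·) atTop v := ⟨2, eventually_map.2 (h.mono fun _ h => h.2.1)⟩
  have hv2 : IsBoundedUnder (· ≥ ·) atTop v := ⟨0, eventually_map.2 (h.mono fun _ h => h.1)⟩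
  have hs1 := isBoundedUnder_le_add hv1 hw.isBoundedUnder_le
  have hs2 := isBoundedUnder_ge_add hv2 hw.isBoundedUnder_ge
  rw [defect, liminf_congr (h.mono fun _ h => h.2.2), ← limsup_add_of_tendsto_zero hv1 hv2 hw]
  exact liminf_const_sub atTop _ 1 hs1 hs2.isCoboundedUnder_le

theorem AlgNondegenerate.defect_le_one (hn : 1 ≤ n) (hm : 1 ≤ m) (hf : f.AlgNondegenerate)
    {d : ℕ} (hd : 1 ≤ d) (P : HomPoly m d) : f.defect P ≤ 1 := by
  have h := hf.eventually_ratio_mem hn hm hd P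
  rw [hf.defect_eq hn hm hd P, sub_le_self_iff]
  exact le_limsup_of_frequently_le (h.mono fun _ h => h.1).frequently
    ⟨2, eventually_map.2 (h.mono fun _ h => h.2.1)⟩

theorem AlgNondegenerate.defect_eq_zero (hn : 1 ≤ n) (hm : 1 ≤ m) (hf : f.AlgNondegenerate)
    {d : ℕ} (hd : 1 ≤ d) {P : HomPoly m d} (hP : f.IsComplete P) : f.defect P = 0 := by
  obtain ⟨C, hC⟩ := hP.exists_proximity_le hn
  refine Tendsto.liminf_eq (squeeze_zero (fun r => ?_) (fun r => ?_)
    (hf.tendsto_const_div hn hm hd C))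
  · exact div_nonneg (f.proximity_nonneg P r)
      (mul_nonneg (Nat.cast_nonneg _) (f.charFun_nonneg hn r))
  · exact div_le_div_of_nonneg_right (hC r)
      (mul_nonneg (Nat.cast_nonneg _) (f.charFun_nonneg hn r))

/-- Complete members contribute 0 and each of the others at most 1. -/
theorem AlgNondegenerate.sum_defect_le_ddg (hn : 1 ≤ n) (hm : 1 ≤ m) (hf : f.AlgNondegenerate)
    {ι : Type*} {deg : ι → ℕ} (hdeg : ∀ j, 1 ≤ deg j) (P : ∀ j, HomPoly m (deg j))
    (S : Finset ι) : ∑ j ∈ S, f.defect (P j) ≤ f.ddg P (S : Set ι) := by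
  classical
  have hset : {j | j ∈ (S : Set ι) ∧ ¬ f.IsComplete (P j)} =
      ((S.filter fun j => ¬ f.IsComplete (P j) : Finset ι) : Set ι) := by
    ext j; simp
  rw [ddg, hset, Set.ncard_coe_finset, Finset.card_filter, Nat.cast_sum]
  refine Finset.sum_le_sum fun j _ => ?_
  split_ifs with h
  · simpa using (hf.defect_eq_zero hn hm (hdeg j) h).le
  · simpa using hf.defect_le_one hn hm (hdeg j) (P j)

end HolomorphicMap

end TropicalNevanlinna

end

/-! ### The defect relations -/

theorem mainTheorem9 (n m q : ℕ) (hn : 1 ≤ n) (hm : 1 ≤ m) (hq : 1 ≤ q)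
    (f : TropicalNevanlinna.HolomorphicMap n m) (hf : f.AlgNondegenerate)
    (deg : Fin q → ℕ) (hdeg : ∀ j, 1 ≤ deg j)
    (P : ∀ j : Fin q, TropicalNevanlinna.HomPoly m (deg j))
    (d M lam : ℕ) (hd : d = Finset.univ.lcm deg) (hM : M = (m + d).choose d - 1)
    (hlam : lam = f.ddg P {j : Fin q | M + 2 ≤ (j : ℕ) + 1})
    (hgrowth : limsup (fun r : ℝ => ((Real.log (f.charFun r) / r : ℝ) : EReal)) atTop = 0) :
    (∀ j : Fin q, f.defect (P j) =
      1 - limsup (fun r : ℝ =>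
        TropicalNevanlinna.countingFun r (fun x => -(f.polyComp (P j) x)) /
          (deg j * f.charFun r)) atTop) ∧
    ∑ j : Fin q, f.defect (P j) ≤ (M : ℝ) + 1 + lam ∧
    ∑ j ∈ Finset.univ.filter (fun j : Fin q => M + 2 ≤ (j : ℕ) + 1), f.defect (P j) ≤ (lam : ℝ) ∧
    (lam = 0 → ∀ j : Fin q, M + 2 ≤ (j : ℕ) + 1 → f.defect (P j) = 0) := by
  have hsum : ∑ j ∈ Finset.univ.filter (fun j : Fin q => M + 2 ≤ (j : ℕ) + 1), f.defect (P j) ≤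
      (lam : ℝ) := by
    have h := hf.sum_defect_le_ddg hn hm hdeg P
      (Finset.univ.filter fun j : Fin q => M + 2 ≤ (j : ℕ) + 1)
    rwa [Finset.coe_filter_univ, ← hlam] at h
  refine ⟨fun j => hf.defect_eq hn hm (hdeg j) (P j), ?_, hsum, fun h0 j hj => ?_⟩
  -- `Fin q` counts from 0, so the excluded indices are those with value below `M + 1`; each carries
  -- a defect of at most 1.
  · have hcard : (Finset.univ.filter fun j : Fin q => ¬ M + 2 ≤ (j : ℕ) + 1).card ≤ M + 1 := by
      rw [← Finset.card_range (M + 1)]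
      refine Finset.card_le_card_of_injOn (fun j => (j : ℕ)) (fun j hj => ?_)
        fun a _ b _ hab => Fin.ext hab
      have := (Finset.mem_filter.1 hj).2
      exact Finset.mem_coe.2 (Finset.mem_range.2 (by dsimp only; omega))
    have hfirst : ∑ j ∈ Finset.univ.filter (fun j : Fin q => ¬ M + 2 ≤ (j : ℕ) + 1),
        f.defect (P j) ≤ (M : ℝ) + 1 :=
      calc _ ≤ ∑ j ∈ Finset.univ.filter (fun j : Fin q => ¬ M + 2 ≤ (j : ℕ) + 1), (1 : ℝ) :=
            Finset.sum_le_sum fun j _ => hf.defect_le_one hn hm (hdeg j) (P j)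
        _ ≤ (M : ℝ) + 1 := by
            rw [Finset.sum_const, nsmul_one]
            exact_mod_cast hcard
    rw [← Finset.sum_filter_add_sum_filter_not Finset.univ
      (fun j : Fin q => M + 2 ≤ (j : ℕ) + 1)]
    linarith
  · refine hf.defect_eq_zero hn hm (hdeg j) ?_
    by_contra hcomp
    have hempty := (Set.ncard_eq_zero (Set.toFinite _)).1 (hlam.symm.trans h0)
    exact (Set.eq_empty_iff_forall_notMem.1 hempty j) ⟨hj, hcomp⟩
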